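/- Let $\alpha$ be an irrational real number and let $f$ be the entire function $f(z)=\sum_{n=0}^\infty e^{2\pi i n^2\alpha}z^n/n!$. Then $f$ has completely regular growth in the sense of Levin–Pfluger with respect to the order $\rho=1$: $f$ is of order $1$ and normal type, i.e. $\limsup_{r\to\infty}\log\log M(r,f)/\log r=1$ and $0<\limsup_{r\to\infty}r^{-1}\log M(r,f)<\infty$, where $M(r,f)=\max_{|z|=r}|f(z)|$, and the functions $z\mapsto t^{-1}\log|f(tz)|$ converge as $t\to\infty$ in the space $D'(\mathbb C)$ of Schwartz distributions. Its indicator $h_f(\theta)=\limsup_{r\to\infty}r^{-1}\log|f(re^{i\theta})|$ is identically equal to $1$. Moreover: (i) There is a set $E\subset\mathbb C$ such that $\log|f(z)|=|z|+o(|z|)$ as $z\to\infty$, $z\notin E$ (uniformly in $\arg z$; in particular $E$ contains all zeros of $f$ of sufficiently large modulus), and such that for every $\eta>0$ the set $E$ can be covered by a sequence of discs with centres $w_k$ and radii $r_k$ satisfying $\sum_{|w_k|\le r}r_k^\eta=o(r^\eta)$ as $r\to\infty$. (ii) The zeros of $f$ have uniform angular density: if $\mu_f$ is the counting measure of the zeros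 of $f$ (with multiplicity), then the measures $B\mapsto t^{-1}\mu_f(tB)$ converge as $t\to\infty$, in the sense of distributions on $\mathbb C$, to the measure $dr\,d\nu(\theta)$ in polar coordinates, where $d\nu=d\theta/(2\pi)$ is the normalized Lebesgue measure on the unit circle. Also, for all real $\theta_1<\theta_2\le\theta_1+2\pi$, the number $n(r,\theta_1,\theta_2)$ of zeros (counting multiplicity) in the sector $\{z:\theta_1<\arg z<\theta_2,\ 0<|z|<r\}$ satisfies $n(r,\theta_1,\theta_2)=\frac{\theta_2-\theta_1}{2\pi}\,(r+o(r))$ as $r\to\infty$. -/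

import Mathlib

open Set Filter Topology MeasureTheory TopologicalSpace
open scoped NNReal ENNReal Real Distributions Nat

noncomputable section

namespace EntireGrowth

/-- The maximum modulus `M(r, f) = max_{|z| = r} |f(z)|`. -/
def maxModulus (f : ℂ → ℂ) (r : ℝ) : ℝ :=
  ⨆ θ : ℝ, ‖f (r * Complex.exp (θ * Complex.I))‖

/-- The order of growth `limsup_{r → ∞} log log M(r, f) / log r`. -/
def order (f : ℂ → ℂ) : EReal :=
  limsup (fun r : ℝ => ((Real.log (Real.log (maxModulus f r)) / Real.log r : ℝ) : EReal)) atTop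

/-- The type with respect to the order `ρ`: `limsup_{r → ∞} r^{-ρ} log M(r, f)`. -/
def typeOfOrder (ρ : ℝ) (f : ℂ → ℂ) : EReal :=
  limsup (fun r : ℝ => ((r ^ (-ρ) * Real.log (maxModulus f r) : ℝ) : EReal)) atTop

/-- The Phragmén–Lindelöf indicator `h_f(θ) = limsup_{r → ∞} r^{-ρ} log |f(r e^{iθ})|`
with respect to the order `ρ`; here `log 0 = -∞`. -/
def plIndicator (ρ : ℝ) (f : ℂ → ℂ) (θ : ℝ) : EReal :=
  limsup (fun r : ℝ => ((r ^ (-ρ) : ℝ) : EReal) *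
    ENNReal.log ‖f (r * Complex.exp (θ * Complex.I))‖ₑ) atTop

/-- The rescaled function `(A_t u)(z) = t^{-ρ} u(t z)`. -/
def rescale (ρ t : ℝ) (u : ℂ → ℝ) (z : ℂ) : ℝ := t ^ (-ρ) * u (t * z)

/-- An entire function of order `ρ` and normal type has completely regular growth if
`A_t log |f|` converges in the space of Schwartz distributions on the plane as `t → ∞`. -/
structure CompletelyRegularGrowth (ρ : ℝ) (f : ℂ → ℂ) : Prop where
  entire : Differentiable ℂ f
  order_eq : order f = (ρ : EReal)
  type_pos : 0 < typeOfOrder ρ f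
  type_lt_top : typeOfOrder ρ f < ⊤
  exists_limit : ∃ u : 𝓓'((⊤ : Opens ℂ), ℝ), ∀ χ : 𝓓((⊤ : Opens ℂ), ℝ),
    Tendsto (fun t : ℝ => ∫ z : ℂ, rescale ρ t (fun w => Real.log ‖f w‖) z * χ z)
      atTop (𝓝 (u χ))

/-- `E` can be covered by discs with centres `w k` and radii `s k` such that
`∑_{|w k| ≤ r} (s k)^η = o(r^η)` as `r → ∞`. -/
def IsSmallExceptional (η : ℝ) (E : Set ℂ) : Prop :=
  ∃ (w : ℕ → ℂ) (s : ℕ → ℝ≥0),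
    E ⊆ ⋃ k, Metric.ball (w k) (s k) ∧
    Tendsto (fun r : ℝ => (∑' k, if ‖w k‖ ≤ r then (s k : ℝ≥0∞) ^ η else 0) /
      ENNReal.ofReal (r ^ η)) atTop (𝓝 0)

/-- The counting measure of the zeros of `f`, with multiplicity. -/
def zeroMeasure (f : ℂ → ℂ) : Measure ℂ :=
  Measure.sum fun z : ℂ => (analyticOrderAt f z : ℝ≥0∞) • Measure.dirac z

/-- The rescaled measure `(A_t μ)(E) = t^{-ρ} μ(t E)`. -/
def rescaleMeasure (ρ t : ℝ) (μ : Measure ℂ) : Measure ℂ :=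
  ENNReal.ofReal (t ^ (-ρ)) • μ.map (fun z : ℂ => z / t)

/-- The measure `r^{ρ-1} dr dν(θ)` in polar coordinates. The measure `ν` on the unit circle is
given as a measure on the line, to be concentrated on one period. -/
def polarMeasure (ρ : ℝ) (ν : Measure ℝ) : Measure ℂ :=
  (((volume.restrict (Ioi (0 : ℝ))).withDensity
      (fun r => ENNReal.ofReal (r ^ (ρ - 1)))).prod ν).map
    (fun p : ℝ × ℝ => (p.1 : ℂ) * Complex.exp (p.2 * Complex.I))

/-- `ν` is the angular density of the zeros of `f` with respect to the order `ρ`: the rescaled zero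
counting measures `A_t μ_f` converge to `r^{ρ-1} dr dν(θ)` in the sense of distributions. -/
def HasAngularDensity (ρ : ℝ) (f : ℂ → ℂ) (ν : Measure ℝ) : Prop :=
  ∀ χ : 𝓓((⊤ : Opens ℂ), ℝ),
    Tendsto (fun t : ℝ => ∫ z, χ z ∂(rescaleMeasure ρ t (zeroMeasure f)))
      atTop (𝓝 (∫ z, χ z ∂(polarMeasure ρ ν)))

/-- The uniform probability measure on the circle, on the period `(-π, π]`. -/
def uniformAngle : Measure ℝ :=
  ENNReal.ofReal (1 / (2 * π)) • volume.restrict (Ioc (-π) π)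

/-- The sector `{z : θ₁ < arg z < θ₂, 0 < |z| < r}`. -/
def sector (θ₁ θ₂ r : ℝ) : Set ℂ :=
  {z | ∃ s θ : ℝ, 0 < s ∧ s < r ∧ θ₁ < θ ∧ θ < θ₂ ∧ z = s * Complex.exp (θ * Complex.I)}

end EntireGrowth

end

/-!
Write `q = e^{2πiα}`, so that `f z = ∑ q ^ (n²) zⁿ / n!`. Termwise differentiation gives the
functional equation `f' (z) = q f (q² z)`, and everything follows from it.

**Large values near every point.** Clearly `|f z| ≤ e^{|z|}`. The `k`-th derivative of `f` satisfies
`|f⁽ᵏ⁾ z| = |f (q^{2k} z)|`; in particular all derivatives at `0` have modulus `1`, and Cauchy's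
inequalities on a circle of radius `r` force `max_{|z| = r} |f z| ≥ (1 - l) e^{l r}` for all `l < 1`
(`exp_le_of_norm_le_on_sphere`). If `|f|` were at most `e^{(1 - ε)|z|}` on a disc of radius `ε |z|`
around some `z`, Cauchy's inequalities would make boundedly many derivatives of `f` small on a
smaller disc, that is, `f` would be small on the images of that disc under the first rotations by
`q²`. As `α` is irrational, these cover the whole circle (`exists_bound_pow_near`), a contradiction
for large `|z|`. Hence `f` has values of size `e^{(1 - ε)|z|}` near every point of large modulus
(`hasLargeValues_of_hasDerivAt`). The order and the type of `f` come from the bounds on the maximum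
modulus; all the rest uses only large values, `|f z| ≤ e^{|z|}` and `f 0 = 1`.

**Growth.** The function `log |f|` is subharmonic and at most `|z|`, and each disc of radius `ε |z|`
contains a point where it is nearly `|z|`. The sub-mean value inequality turns this into
`log |f (t z)| / t → |z|` in `L¹` on compact sets (`lintegral_defect_le`,
`tendsto_integral_rescale_log_norm`), which is completely regular growth. The exceptional set is
obtained in the manner of Cartan's lemma: up to a multiple of `ε |z|`, Jensen's formula bounds
`|z| - log |f z|` by a logarithmic potential of the zeros in a small disc around `z`, and this
potential is small unless zeros accumulate too much around `z`; Vitali's covering lemma covers the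
latter points by discs with small radii in every dyadic shell (`eventually_hasShellCover`). A
diagonal choice of the parameters produces a single set for all exponents
(`exists_exceptional_set`), and since the discs for the exponent `1` cannot cover a segment of a
ray, the indicator is `1` in all directions (`plIndicator_eq_one`).

**Zeros.** Instead of the distributional Laplacian, averages over circles of a small radius `s` are
used. For a test function `χ`, let `χ_s` be its convolution with the kernel `log⁺ (s / |w|)`.
Jensen's formula, integrated against `χ`, says that `∫ log |g| (A_s χ - χ) = ∫ χ_s dμ_g` for every
entire function `g` with zero counting measure `μ_g`, where `A_s` is averaging over circles of
radius `s` (`integral_log_norm_mul_circleAverage_sub`). The same identity holds for `|z|` in place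
of `log |g|` and the measure `dr dθ / 2π` in place of `μ_g`, because `|z|` is, up to a constant, the
logarithmic potential of that measure (`integral_norm_mul_circleAverage_sub`). So the convergence of
`log |f (t z)| / t` yields the convergence of the rescaled zero counting measures against `χ_s`, and
as `s → 0` against `χ` itself (`tendsto_integral_rescaleMeasure`). As the limit does not charge the
boundaries of sectors, it also counts the zeros in sectors (`tendsto_zeroMeasure_sector`).
-/

/-! ### The functional equation and large values -/

/-- `f` takes values of modulus at least `exp ((1 - ε) |z|)` at distance at most `ε |z|` from every
point `z` of sufficiently large modulus. -/
def HasLargeValues (f : ℂ → ℂ) : Prop :=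
  ∀ ε : ℝ, 0 < ε → ∃ R : ℝ, ∀ z : ℂ, R ≤ ‖z‖ →
    ∃ z₁ : ℂ, ‖z₁ - z‖ ≤ ε * ‖z‖ ∧ Real.exp ((1 - ε) * ‖z‖) ≤ ‖f z₁‖

/-- Termwise differentiation of `∑ q ^ (n²) zⁿ / n!` yields `f' (z) = q f (q² z)`. -/
theorem hasDerivAt_of_hasSum_sq {q : ℂ} (hq : ‖q‖ = 1) {f : ℂ → ℂ}
    (hf : ∀ z, HasSum (fun n : ℕ => q ^ (n ^ 2) * z ^ n / (n ! : ℂ)) (f z)) (z : ℂ) :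
    HasDerivAt f (q * f (q ^ 2 * z)) z := by
  have hfe : f = fun z => ∑' n : ℕ, q ^ (n ^ 2) * z ^ n / (n ! : ℂ) :=
    funext fun z => (hf z).tsum_eq.symm
  set R := ‖z‖ + 1 with hR
  have hR1 : 1 ≤ R := by have := norm_nonneg z; linarith
  have key := hasDerivAt_tsum_of_isPreconnected
    (g := fun (n : ℕ) (z : ℂ) => q ^ (n ^ 2) * z ^ n / (n ! : ℂ))
    (g' := fun (n : ℕ) (z : ℂ) => q ^ (n ^ 2) * (n * z ^ (n - 1)) / (n ! : ℂ))
    (u := fun n : ℕ => (n * R ^ (n - 1)) / (n ! : ℝ)) (t := Metric.ball (0 : ℂ) R)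
    (y₀ := 0) (y := z) ?_ Metric.isOpen_ball (convex_ball _ _).isPreconnected ?_ ?_
    (Metric.mem_ball_self (by linarith)) (hf 0).summable (by simp [hR])
  · rw [← hfe] at key
    have hsum : HasSum (fun n : ℕ => q ^ (n ^ 2) * (n * z ^ (n - 1)) / (n ! : ℂ))
        (q * f (q ^ 2 * z)) := by
      rw [← hasSum_nat_add_iff' 1]
      simp only [Finset.range_one, Finset.sum_singleton, Nat.cast_zero, zero_mul, mul_zero,
        zero_div, sub_zero]
      refine ((hf (q ^ 2 * z)).mul_left q).congr_fun fun n => ?_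
      have h1 : ((n + 1 : ℕ) : ℂ) ≠ 0 := by exact_mod_cast Nat.succ_ne_zero n
      have h2 : (n ! : ℂ) ≠ 0 := by exact_mod_cast Nat.factorial_ne_zero n
      rw [Nat.factorial_succ, Nat.add_sub_cancel]
      push_cast at h1 ⊢
      field_simp
      ring
    rwa [hsum.tsum_eq] at key
  · rw [← summable_nat_add_iff 1]
    refine (Real.summable_pow_div_factorial R).congr fun n => ?_
    have h1 : ((n + 1 : ℕ) : ℝ) ≠ 0 := by exact_mod_cast Nat.succ_ne_zero n
    have h2 : (n ! : ℝ) ≠ 0 := by exact_mod_cast Nat.factorial_ne_zero n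
    rw [Nat.factorial_succ, Nat.add_sub_cancel]
    push_cast at h1 ⊢
    field_simp
  · intro n y _
    exact ((hasDerivAt_pow n y).const_mul _).div_const _
  · intro n y hy
    rw [mem_ball_zero_iff] at hy
    simp only [norm_div, norm_mul, norm_pow, hq, one_pow, one_mul, Complex.norm_natCast]
    gcongr

theorem norm_le_exp_of_hasSum_sq {q : ℂ} (hq : ‖q‖ = 1) {f : ℂ → ℂ}
    (hf : ∀ z, HasSum (fun n : ℕ => q ^ (n ^ 2) * z ^ n / (n ! : ℂ)) (f z)) (z : ℂ) :
    ‖f z‖ ≤ Real.exp ‖z‖ := by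
  have h := NormedSpace.expSeries_div_hasSum_exp (𝔸 := ℝ) ‖z‖
  rw [← Real.exp_eq_exp_ℝ] at h
  refine (hf z).norm_le_of_bounded h fun n => ?_
  simp [hq]

section FunctionalEquation

variable {p q : ℂ} {f : ℂ → ℂ}

theorem exists_iteratedDeriv_eq (hp : ‖p‖ = 1) (hq : ‖q‖ = 1)
    (hd : ∀ z, HasDerivAt f (q * f (p * z)) z) (k : ℕ) :
    ∃ c : ℂ, ‖c‖ = 1 ∧ iteratedDeriv k f = fun z => c * f (p ^ k * z) := by
  induction k with
  | zero => exact ⟨1, by simp, by ext; simp⟩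
  | succ k ih =>
    obtain ⟨c, hc, h⟩ := ih
    refine ⟨c * p ^ k * q, by simp [hc, hp, hq], ?_⟩
    rw [iteratedDeriv_succ, h]
    ext z
    have := ((hd (p ^ k * z)).comp z ((hasDerivAt_id z).const_mul (p ^ k))).const_mul c
    refine this.deriv.trans ?_
    simp only [pow_succ']
    rw [mul_assoc p]
    ring_nf

theorem norm_iteratedDeriv_eq (hp : ‖p‖ = 1) (hq : ‖q‖ = 1)
    (hd : ∀ z, HasDerivAt f (q * f (p * z)) z) (k : ℕ) (z : ℂ) :
    ‖iteratedDeriv k f z‖ = ‖f (p ^ k * z)‖ := by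
  obtain ⟨c, hc, h⟩ := exists_iteratedDeriv_eq hp hq hd k
  rw [h, norm_mul, hc, one_mul]

/-- All Taylor coefficients of `f` have modulus `1 / n!`, so Cauchy's estimates bound the maximum
modulus from below; summing them against `l ^ n` replaces Stirling's formula. -/
theorem exp_le_of_norm_le_on_sphere (hp : ‖p‖ = 1) (hq : ‖q‖ = 1)
    (hd : ∀ z, HasDerivAt f (q * f (p * z)) z) (h0 : f 0 = 1) {r l C : ℝ} (hr : 0 < r)
    (hl0 : 0 ≤ l) (hl1 : l < 1) (hC : ∀ z, ‖z‖ = r → ‖f z‖ ≤ C) :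
    Real.exp (l * r) ≤ C / (1 - l) := by
  have hdiff : Differentiable ℂ f := fun z => (hd z).differentiableAt
  have hcoef (n : ℕ) : r ^ n / n ! ≤ C := by
    have h := Complex.norm_iteratedDeriv_le_of_forall_mem_sphere_norm_le (c := 0) n hr
      hdiff.diffContOnCl (fun z hz => hC z (by simpa using hz))
    rw [norm_iteratedDeriv_eq hp hq hd, mul_zero, h0, norm_one, le_div_iff₀ (by positivity),
      one_mul] at h
    rw [div_le_iff₀ (by positivity)]
    linarith
  have h1 := NormedSpace.expSeries_div_hasSum_exp (𝔸 := ℝ) (l * r)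
  rw [← Real.exp_eq_exp_ℝ] at h1
  have h2 := (hasSum_geometric_of_lt_one hl0 hl1).mul_left C
  rw [div_eq_mul_inv]
  refine hasSum_le (fun n => ?_) h1 h2
  rw [mul_pow, mul_div_assoc, mul_comm]
  exact mul_le_mul_of_nonneg_right (hcoef n) (pow_nonneg hl0 n)

/-- If `f` were small on a disc, Cauchy's estimates would make its derivatives small there; up to
unimodular factors these are the values of `f` on rotated discs, finitely many of which cover the
circle, in contradiction to the lower bound for the maximum modulus. -/
theorem hasLargeValues_of_hasDerivAt (hp : ‖p‖ = 1) (hq : ‖q‖ = 1)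
    (hd : ∀ z, HasDerivAt f (q * f (p * z)) z) (h0 : f 0 = 1)
    (hrot : ∀ δ : ℝ, 0 < δ → ∃ K : ℕ, ∀ v : ℂ, ‖v‖ = 1 → ∃ k ≤ K, ‖p ^ k - v‖ < δ) :
    HasLargeValues f := by
  have hdiff : Differentiable ℂ f := fun z => (hd z).differentiableAt
  have main : ∀ ε : ℝ, 0 < ε → ε ≤ 1 → ∃ R : ℝ, ∀ z : ℂ, R ≤ ‖z‖ →
    ∃ z₁ : ℂ, ‖z₁ - z‖ ≤ ε * ‖z‖ ∧ Real.exp ((1 - ε) * ‖z‖) ≤ ‖f z₁‖ := by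
    intro ε hε hε1
    obtain ⟨K, hK⟩ := hrot (ε / 2) (by positivity)
    have hlim : Tendsto (fun r : ℝ => Real.exp (ε / 2 * r)) atTop atTop :=
      Real.tendsto_exp_atTop.comp (tendsto_id.const_mul_atTop (by positivity))
    obtain ⟨R, hR⟩ := eventually_atTop.1 ((hlim.eventually_gt_atTop (2 * K ! / ε)).and
      (eventually_ge_atTop (2 / ε)))
    refine ⟨R, fun z₀ hz₀ => ?_⟩
    obtain ⟨hR1, hR2⟩ := hR _ hz₀
    set r := ‖z₀‖ with hr
    have hr0 : 0 < r := lt_of_lt_of_le (by positivity) hR2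
    have hz0 : z₀ ≠ 0 := norm_pos_iff.1 hr0
    have hεr : 1 ≤ ε * r / 2 := by
      rw [div_le_iff₀ hε] at hR2; linarith
    by_contra! hcon
    have hsmall : ∀ z, ‖z‖ = r → ‖f z‖ ≤ K ! * Real.exp ((1 - ε) * r) := by
      intro z hz
      -- `z / p ^ k` is close to `z₀`, and `|f z|` is the modulus of the `k`-th derivative there.
      obtain ⟨k, hkK, hk⟩ := hK (z / z₀) (by rw [norm_div, hz, ← hr, div_self hr0.ne'])
      have hpk : p ^ k ≠ 0 := pow_ne_zero _ (norm_pos_iff.1 (by rw [hp]; exact one_pos))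
      have hpk1 : ‖p ^ k‖ = 1 := by rw [norm_pow, hp, one_pow]
      set w := z / p ^ k with hw
      have hwz : p ^ k * w = z := by rw [hw]; field_simp
      have hw0 : ‖w - z₀‖ ≤ ε * r / 2 := by
        have e1 : ‖w - z₀‖ = ‖p ^ k * (w - z₀)‖ := by rw [norm_mul, hpk1, one_mul]
        have e2 : p ^ k * (w - z₀) = (z / z₀ - p ^ k) * z₀ := by
          rw [mul_sub, hwz, sub_mul, div_mul_cancel₀ _ hz0]
        rw [e1, e2, norm_mul, norm_sub_rev, ← hr]
        nlinarith
      have hcau := Complex.norm_iteratedDeriv_le_of_forall_mem_sphere_norm_le (f := f) (c := w)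
        (R := ε * r / 2) (C := Real.exp ((1 - ε) * r)) k (by positivity) hdiff.diffContOnCl
        (fun y hy => (hcon y (by
          rw [mem_sphere_iff_norm] at hy
          calc ‖y - z₀‖ ≤ ‖y - w‖ + ‖w - z₀‖ := norm_sub_le_norm_sub_add_norm_sub _ _ _
            _ ≤ ε * r := by rw [hy]; linarith)).le)
      rw [norm_iteratedDeriv_eq hp hq hd, hwz] at hcau
      refine hcau.trans ((div_le_self (by positivity) (one_le_pow₀ hεr)).trans ?_)
      gcongr
    -- Any `l` strictly between `1 - ε` and `1` contradicts `hsmall` for large `r`.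
    have h1 := exp_le_of_norm_le_on_sphere hp hq hd h0 (l := 1 - ε / 2) hr0 (by linarith)
      (by linarith) hsmall
    have e : (1 - ε / 2) * r = (1 - ε) * r + ε / 2 * r := by ring
    rw [e, Real.exp_add] at h1
    have h2 : Real.exp (ε / 2 * r) ≤ 2 * K ! / ε := by
      have hpos := Real.exp_pos ((1 - ε) * r)
      refine le_of_mul_le_mul_left (h1.trans (le_of_eq ?_)) hpos
      rw [show 1 - (1 - ε / 2) = ε / 2 by ring]
      field_simp
    linarith
  intro ε hε
  obtain ⟨R, hR⟩ := main (min ε 1) (by positivity) (min_le_right _ _)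
  refine ⟨R, fun z hz => ?_⟩
  obtain ⟨z₁, h1, h2⟩ := hR z hz
  refine ⟨z₁, h1.trans (by gcongr; exact min_le_left _ _), le_trans ?_ h2⟩
  gcongr
  exact min_le_left _ _

end FunctionalEquation

/-- Powers of `exp (2πiβ)`, `β` irrational, are dense in the circle, uniformly in the sense that
boundedly many suffice for a given precision. -/
theorem exists_bound_pow_near {β : ℝ} (hβ : Irrational β) (δ : ℝ) (hδ : 0 < δ) :
    ∃ K : ℕ, ∀ v : ℂ, ‖v‖ = 1 → ∃ k ≤ K, ‖Complex.exp (2 * π * Complex.I * β) ^ k - v‖ < δ := by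
  set p := Complex.exp (2 * π * Complex.I * β) with hpdef
  have hp : ‖p‖ = 1 := by
    rw [hpdef, show (2 * π * Complex.I * β : ℂ) = ((2 * π * β : ℝ) : ℂ) * Complex.I by
      push_cast; ring, Complex.norm_exp_ofReal_mul_I]
  have hp0 : p ≠ 0 := Complex.exp_ne_zero _
  have hdense : ∀ v : ℂ, ‖v‖ = 1 → ∃ m : ℤ, ‖p ^ m - v‖ < δ := by
    intro v hv
    set x := Complex.arg v / (2 * π) with hx
    have hvx : v = Complex.exp ((2 * π * x : ℝ) * Complex.I) := by
      have h := Complex.norm_mul_exp_arg_mul_I v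
      rw [hv, Complex.ofReal_one, one_mul] at h
      rw [hx, mul_div_cancel₀ _ (by positivity : (2 * π : ℝ) ≠ 0), h]
    have hd : Dense (AddSubgroup.closure {β, (1 : ℝ)} : Set ℝ) :=
      dense_addSubgroupClosure_pair_iff.2 (by simpa using hβ)
    obtain ⟨y, hyb, hy⟩ := Metric.dense_iff.1 hd x (δ / (2 * π)) (by positivity)
    obtain ⟨m, n, hmn⟩ := AddSubgroup.mem_closure_pair.1 hy
    refine ⟨m, ?_⟩
    have hpm : p ^ m = Complex.exp ((2 * π * y : ℝ) * Complex.I) := by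
      rw [← hmn, hpdef, ← Complex.exp_int_mul]
      have : ((2 * π * (m • β + n • (1 : ℝ)) : ℝ) : ℂ) * Complex.I
          = m * (2 * π * Complex.I * β) + n * (2 * π * Complex.I) := by
        push_cast [zsmul_eq_mul]; ring
      rw [this, Complex.exp_add, Complex.exp_int_mul_two_pi_mul_I, mul_one]
    have hyx : |y - x| < δ / (2 * π) := by simpa [Real.dist_eq] using hyb
    have hfac : Complex.exp ((2 * π * y : ℝ) * Complex.I)
        - Complex.exp ((2 * π * x : ℝ) * Complex.I)
        = Complex.exp ((2 * π * x : ℝ) * Complex.I) *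
          (Complex.exp (Complex.I * (2 * π * (y - x) : ℝ)) - 1) := by
      rw [mul_sub, ← Complex.exp_add, mul_one]
      congr 2
      push_cast; ring
    rw [hpm, hvx, hfac, norm_mul, Complex.norm_exp_ofReal_mul_I, one_mul]
    refine lt_of_le_of_lt (Real.norm_exp_I_mul_ofReal_sub_one_le) ?_
    rw [Real.norm_eq_abs, abs_mul, abs_of_pos (by positivity : (0:ℝ) < 2 * π)]
    rw [lt_div_iff₀ (by positivity)] at hyx
    linarith
  obtain ⟨T, hT⟩ := (isCompact_sphere (0 : ℂ) 1).elim_finite_subcover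
    (fun m : ℤ => Metric.ball (p ^ m) δ) (fun _ => Metric.isOpen_ball) (by
      intro v hv
      obtain ⟨m, hm⟩ := hdense v (by simpa using hv)
      exact mem_iUnion.2 ⟨m, by rw [mem_ball_iff_norm, norm_sub_rev]; exact hm⟩)
  -- Shift the exponents of the finite cover so that they become nonnegative.
  set N := ∑ m ∈ T, m.natAbs with hN
  refine ⟨2 * N, fun v hv => ?_⟩
  have hv' : v / p ^ N ∈ Metric.sphere (0 : ℂ) 1 := by simp [hv, hp]
  obtain ⟨m, hmT, hm⟩ := mem_iUnion₂.1 (hT hv')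
  have hmN : m.natAbs ≤ N := Finset.single_le_sum (f := Int.natAbs) (fun _ _ => Nat.zero_le _) hmT
  refine ⟨(m + N).toNat, by omega, ?_⟩
  have e : p ^ (m + N).toNat = p ^ m * p ^ N := by
    rw [← zpow_natCast, Int.toNat_of_nonneg (by omega), zpow_add₀ hp0, zpow_natCast]
  rw [e, show p ^ m * p ^ N - v = (p ^ m - v / p ^ N) * p ^ N by
    rw [sub_mul, div_mul_cancel₀ _ (pow_ne_zero _ hp0)], norm_mul, norm_pow, hp, one_pow, mul_one,
    norm_sub_rev]
  rwa [mem_ball_iff_norm] at hm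

/-! ### Jensen's formula and area integrals of `log |g|` -/

section Entire

open Metric EntireGrowth

variable {g : ℂ → ℂ}

theorem analyticOrderAt_ne_top_of_entire (hg : Differentiable ℂ g) {z₀ : ℂ} (h₀ : g z₀ ≠ 0)
    (z : ℂ) : analyticOrderAt g z ≠ ⊤ := by
  intro h
  rw [analyticOrderAt_eq_top] at h
  have := AnalyticOnNhd.eq_of_eventuallyEq (f := g) (g := 0)
    (fun w _ => hg.analyticAt w) (fun w _ => analyticAt_const) h
  exact h₀ (congrFun this z₀)

theorem finite_zeros_closedBall (hg : Differentiable ℂ g) {z₀ : ℂ} (h₀ : g z₀ ≠ 0) (c : ℂ)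
    (R : ℝ) : {a | a ∈ closedBall c R ∧ g a = 0}.Finite := by
  have han : AnalyticOnNhd ℂ g (closedBall c R) := fun w _ => hg.analyticAt w
  refine ((MeromorphicOn.divisor g (closedBall c R)).finiteSupport
    (isCompact_closedBall c R)).subset ?_
  rintro a ⟨ha, hga⟩
  rw [Function.mem_support, MeromorphicOn.AnalyticOnNhd.divisor_apply han ha]
  have h1 : analyticOrderAt g a ≠ 0 := fun h => (hg.analyticAt a).analyticOrderAt_eq_zero.1 h hga
  have h2 := analyticOrderAt_ne_top_of_entire hg h₀ a
  lift analyticOrderAt g a to ℕ using h2 with n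
  simp only [ne_eq, Nat.cast_eq_zero] at h1
  simpa using h1

/-- Jensen's formula over a finite set `F` containing the zeros in the disc; thanks to `log⁺`, zeros
in `F` outside the disc do not contribute. -/
theorem jensen_sum (hg : Differentiable ℂ g) {z : ℂ} (hz : g z ≠ 0) {s : ℝ} (hs : 0 < s)
    {F : Finset ℂ} (hF : ∀ a ∈ closedBall z s, g a = 0 → a ∈ F) :
    Real.circleAverage (fun w => Real.log ‖g w‖) z s = Real.log ‖g z‖ +
      ∑ a ∈ F, (analyticOrderNatAt g a : ℝ) * Real.posLog (s / ‖z - a‖) := by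
  have han : AnalyticOnNhd ℂ g (closedBall z |s|) := fun w _ => hg.analyticAt w
  have hcong (a : ℂ) : (MeromorphicOn.divisor g (closedBall z |s|) a : ℝ)
      * Real.log (s * ‖z - a‖⁻¹) = (analyticOrderNatAt g a : ℝ) * Real.posLog (s / ‖z - a‖) := by
    by_cases ha : a ∈ closedBall z |s|
    · rw [MeromorphicOn.AnalyticOnNhd.divisor_apply han ha]
      have h2 := analyticOrderAt_ne_top_of_entire hg hz a
      rw [analyticOrderNatAt]
      by_cases haz : a = z
      · have : analyticOrderAt g a = 0 := by
          rw [haz]; exact (hg.analyticAt z).analyticOrderAt_eq_zero.2 hz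
        simp [this]
      lift analyticOrderAt g a to ℕ using h2 with n
      rw [Real.posLog_eq_log]
      · simp [div_eq_mul_inv]
      · have hpos : 0 < ‖z - a‖ := norm_pos_iff.2 (sub_ne_zero.2 (Ne.symm haz))
        rw [abs_of_nonneg (by positivity), le_div_iff₀ hpos, one_mul]
        rw [abs_of_pos hs, mem_closedBall_iff_norm, norm_sub_rev] at ha
        exact ha
    · have h1 : MeromorphicOn.divisor g (closedBall z |s|) a = 0 :=
        (MeromorphicOn.divisor g (closedBall z |s|)).apply_eq_zero_of_notMem ha
      rw [abs_of_pos hs, mem_closedBall_iff_norm, norm_sub_rev, not_le] at ha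
      have h2 : Real.posLog (s / ‖z - a‖) = 0 := by
        rw [Real.posLog_eq_zero_iff, abs_of_nonneg (by positivity),
          div_le_one (hs.trans ha)]
        exact ha.le
      rw [h1, h2]; simp
  rw [han.circleAverage_log_norm hs.ne' hz, add_comm, finsum_congr hcong,
    finsum_eq_sum_of_support_subset]
  intro a ha
  rw [Function.mem_support] at ha
  apply hF
  · rw [mem_closedBall_iff_norm, norm_sub_rev]
    by_contra hlt
    rw [not_le] at hlt
    apply ha
    rw [(Real.posLog_eq_zero_iff _).2, mul_zero]
    rw [abs_of_nonneg (by positivity), div_le_one (hs.trans hlt)]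
    exact hlt.le
  · by_contra hne
    apply ha
    rw [analyticOrderNatAt, (hg.analyticAt a).analyticOrderAt_eq_zero.2 hne]
    simp

theorem circleIntegrable_log_norm_entire (hg : Differentiable ℂ g) (z : ℂ) (s : ℝ) :
    CircleIntegrable (fun w => Real.log ‖g w‖) z s :=
  MeromorphicOn.circleIntegrable_log_norm fun w _ => (hg.analyticAt w).meromorphicAt

theorem log_norm_le_circleAverage (hg : Differentiable ℂ g) {z : ℂ} (hz : g z ≠ 0) {s : ℝ}
    (hs : 0 < s) : Real.log ‖g z‖ ≤ Real.circleAverage (fun w => Real.log ‖g w‖) z s := by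
  have hfin := finite_zeros_closedBall hg hz z s
  rw [jensen_sum hg hz hs (F := hfin.toFinset)
    (fun a h1 h2 => by simpa using ⟨by simpa using h1, h2⟩)]
  have : 0 ≤ ∑ a ∈ hfin.toFinset, (analyticOrderNatAt g a : ℝ) * Real.posLog (s / ‖z - a‖) :=
    Finset.sum_nonneg fun a _ => mul_nonneg (Nat.cast_nonneg _) Real.posLog_nonneg
  linarith

theorem circleAverage_log_norm_mono (hg : Differentiable ℂ g) {z : ℂ} (hz : g z ≠ 0) {r s : ℝ}
    (hr : 0 < r) (hrs : r ≤ s) : Real.circleAverage (fun w => Real.log ‖g w‖) z r ≤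
      Real.circleAverage (fun w => Real.log ‖g w‖) z s := by
  have hfin := finite_zeros_closedBall hg hz z s
  rw [jensen_sum hg hz (hr.trans_le hrs) (F := hfin.toFinset)
      (fun a h1 h2 => by simpa using ⟨by simpa using h1, h2⟩),
    jensen_sum hg hz hr (F := hfin.toFinset)
      (fun a h1 h2 => by simpa using ⟨by simpa using closedBall_subset_closedBall hrs h1, h2⟩)]
  gcongr

/-- Inside a closed disc, the zero counting measure is a finite sum of point masses. -/
theorem zeroMeasure_restrict_closedBall (hg : Differentiable ℂ g) {z₀ : ℂ} (h₀ : g z₀ ≠ 0) {c : ℂ}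
    {R : ℝ} {F : Finset ℂ} (hF : ∀ a, a ∈ F ↔ a ∈ closedBall c R ∧ g a = 0) :
    (zeroMeasure g).restrict (closedBall c R) =
      ∑ a ∈ F, (analyticOrderNatAt g a : ℝ≥0∞) • Measure.dirac a := by
  ext B hB
  rw [Measure.restrict_apply hB, zeroMeasure,
    Measure.sum_apply _ (hB.inter measurableSet_closedBall), Measure.finsetSum_apply]
  rw [tsum_eq_sum (s := F)]
  · refine Finset.sum_congr rfl fun a ha => ?_
    have haR := ((hF a).1 ha).1
    have h2 := analyticOrderAt_ne_top_of_entire hg h₀ a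
    rw [analyticOrderNatAt, Measure.smul_apply, Measure.smul_apply, Measure.dirac_apply' _ hB,
      Measure.dirac_apply' _ (hB.inter measurableSet_closedBall)]
    lift analyticOrderAt g a to ℕ using h2 with n
    congr 1
    by_cases hab : a ∈ B
    · rw [indicator_of_mem hab, indicator_of_mem (show a ∈ B ∩ closedBall c R from ⟨hab, haR⟩)]
    · rw [indicator_of_notMem hab, indicator_of_notMem (fun h => hab h.1)]
  · intro a ha
    rw [Measure.smul_apply, Measure.dirac_apply' _ (hB.inter measurableSet_closedBall)]
    by_cases hga : g a = 0
    · have haR : a ∉ closedBall c R := fun h => ha ((hF a).2 ⟨h, hga⟩)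
      rw [indicator_of_notMem (fun h => haR h.2), smul_zero]
    · rw [(hg.analyticAt a).analyticOrderAt_eq_zero.2 hga]
      simp

/-- Jensen's formula in terms of the zero counting measure. -/
theorem jensen_lintegral (hg : Differentiable ℂ g) {z : ℂ} (hz : g z ≠ 0) {s : ℝ} (hs : 0 < s) :
    ∫⁻ a, ENNReal.ofReal (Real.posLog (s / ‖z - a‖)) ∂(zeroMeasure g) =
      ENNReal.ofReal (Real.circleAverage (fun w => Real.log ‖g w‖) z s - Real.log ‖g z‖) := by
  have hfin := finite_zeros_closedBall hg hz z s
  have h := zeroMeasure_restrict_closedBall hg hz (c := z) (R := s) (F := hfin.toFinset) (by simp)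
  rw [← setLIntegral_eq_of_support_subset (s := closedBall z s), h, lintegral_finsetSum_measure,
    jensen_sum hg hz hs (F := hfin.toFinset)
      (fun a h1 h2 => by simpa using ⟨by simpa using h1, h2⟩),
    add_sub_cancel_left, ENNReal.ofReal_sum_of_nonneg
      fun a _ => mul_nonneg (Nat.cast_nonneg _) Real.posLog_nonneg]
  · refine Finset.sum_congr rfl fun a _ => ?_
    rw [lintegral_smul_measure, lintegral_dirac, ENNReal.ofReal_mul (Nat.cast_nonneg _),
      ENNReal.ofReal_natCast, smul_eq_mul]
  · intro a ha
    rw [Function.mem_support] at ha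
    rw [mem_closedBall_iff_norm, norm_sub_rev]
    by_contra hlt
    rw [not_le] at hlt
    apply ha
    rw [(Real.posLog_eq_zero_iff _).2, ENNReal.ofReal_zero]
    rw [abs_of_nonneg (by positivity), div_le_one (hs.trans hlt)]
    exact hlt.le

/-- The number of zeros in a disc, bounded through Jensen's formula for the disc of twice the
radius. -/
theorem zeroMeasure_closedBall_le (hg : Differentiable ℂ g) {z : ℂ} (hz : g z ≠ 0) {r M : ℝ}
    (hr : 0 < r) (hM : ∀ w ∈ sphere z (2 * r), Real.log ‖g w‖ ≤ M) :
    ENNReal.ofReal (Real.log 2) * zeroMeasure g (closedBall z r) ≤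
      ENNReal.ofReal (M - Real.log ‖g z‖) := by
  have h1 : Real.circleAverage (fun w => Real.log ‖g w‖) z (2 * r) ≤ M := by
    refine Real.circleAverage_mono_on_of_le_circle (circleIntegrable_log_norm_entire hg z _)
      fun w hw => hM w ?_
    rwa [abs_of_pos (by positivity)] at hw
  calc ENNReal.ofReal (Real.log 2) * zeroMeasure g (closedBall z r)
      = ∫⁻ _ in closedBall z r, ENNReal.ofReal (Real.log 2) ∂(zeroMeasure g) := by
        rw [setLIntegral_const]
    _ ≤ ∫⁻ a in closedBall z r, ENNReal.ofReal (Real.posLog (2 * r / ‖z - a‖))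
          ∂(zeroMeasure g) := by
        have hfin := finite_zeros_closedBall hg hz z r
        rw [zeroMeasure_restrict_closedBall hg hz (c := z) (R := r) (F := hfin.toFinset) (by simp),
          lintegral_finsetSum_measure, lintegral_finsetSum_measure]
        refine Finset.sum_le_sum fun a ha => ?_
        rw [lintegral_smul_measure, lintegral_smul_measure, lintegral_dirac, lintegral_dirac]
        have ha' : a ∈ closedBall z r ∧ g a = 0 := by simpa using ha
        have hpos : 0 < ‖z - a‖ :=
          norm_pos_iff.2 (sub_ne_zero.2 fun h => hz (by rw [h]; exact ha'.2))
        have hle : 2 ≤ 2 * r / ‖z - a‖ := by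
          rw [le_div_iff₀ hpos]
          have := ha'.1
          rw [mem_closedBall_iff_norm, norm_sub_rev] at this
          linarith
        gcongr
        rw [Real.posLog_eq_log (by rw [abs_of_nonneg (by positivity)]; linarith)]
        exact Real.log_le_log (by norm_num) hle
    _ ≤ ∫⁻ a, ENNReal.ofReal (Real.posLog (2 * r / ‖z - a‖)) ∂(zeroMeasure g) :=
        setLIntegral_le_lintegral _ _
    _ ≤ _ := by
        rw [jensen_lintegral hg hz (by positivity)]
        gcongr

/-- Polar coordinates on `ℂ` for the lower Lebesgue integral. -/
theorem lintegral_eq_lintegral_circleMap {h : ℂ → ℝ≥0∞} (hh : Measurable h) (z : ℂ) :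
    ∫⁻ w, h w = ∫⁻ r in Ioi (0 : ℝ), ENNReal.ofReal r *
      ∫⁻ θ in Ioo (-π) π, h (circleMap z r θ) := by
  rw [← lintegral_add_left_eq_self h z, ← Complex.lintegral_comp_polarCoord_symm, polarCoord_target,
    Measure.volume_eq_prod, ← Measure.prod_restrict]
  have e (p : ℝ × ℝ) : z + Complex.polarCoord.symm p = circleMap z p.1 p.2 := by
    rw [Complex.polarCoord_symm_apply, circleMap, Complex.exp_mul_I]
    push_cast
    ring
  simp_rw [e]
  have hm : Measurable fun p : ℝ × ℝ => h (circleMap z p.1 p.2) := by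
    refine hh.comp ?_
    unfold circleMap
    fun_prop
  rw [lintegral_prod _ (by fun_prop)]
  refine lintegral_congr fun r => ?_
  simp only [smul_eq_mul]
  rw [lintegral_const_mul _ (by fun_prop)]

theorem measurable_log_norm_entire (hg : Differentiable ℂ g) :
    Measurable fun w => Real.log ‖g w‖ :=
  Real.measurable_log.comp hg.continuous.norm.measurable

/-- The area integral over a disc as an integral of circle averages. -/
theorem lintegral_ball_sub_log_norm (hg : Differentiable ℂ g) (z : ℂ) {S M : ℝ}
    (hM : ∀ w ∈ ball z S, Real.log ‖g w‖ ≤ M) :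
    ∫⁻ w in ball z S, ENNReal.ofReal (M - Real.log ‖g w‖) = ∫⁻ r in Ioo 0 S,
      ENNReal.ofReal (r * (2 * π *
        (M - Real.circleAverage (fun w => Real.log ‖g w‖) z r))) := by
  have hmeas := measurable_log_norm_entire hg
  rw [← lintegral_indicator measurableSet_ball, lintegral_eq_lintegral_circleMap
    (Measurable.indicator (by fun_prop) measurableSet_ball) z,
    ← Ioi_inter_Iio (a := (0 : ℝ)) (b := S), inter_comm,
    ← Measure.restrict_restrict measurableSet_Iio,
    ← lintegral_indicator measurableSet_Iio]
  refine setLIntegral_congr_fun measurableSet_Ioi fun r hr => ?_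
  have hr0 : 0 < r := hr
  by_cases hrS : r < S
  · have hin (θ : ℝ) : circleMap z r θ ∈ ball z S := by
      rw [mem_ball_iff_norm, circleMap_sub_center, norm_circleMap_zero, abs_of_pos hr0]
      exact hrS
    simp only [indicator_of_mem (hin _), indicator_of_mem (show r ∈ Iio S from hrS)]
    rw [ENNReal.ofReal_mul hr0.le]
    congr 1
    have hper : Function.Periodic (fun θ : ℝ => M - Real.log ‖g (circleMap z r θ)‖) (2 * π) :=
      fun θ => by simp only [periodic_circleMap z r θ]
    have hci : IntervalIntegrable (fun θ => M - Real.log ‖g (circleMap z r θ)‖) volume 0 (2 * π) :=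
      intervalIntegrable_const.sub (circleIntegrable_log_norm_entire hg z r)
    have hci' : IntervalIntegrable (fun θ => M - Real.log ‖g (circleMap z r θ)‖) volume (-π) π :=
      (hper.intervalIntegrable₀ Real.two_pi_pos.ne' hci) _ _
    rw [← ofReal_integral_eq_lintegral_ofReal]
    · congr 1
      rw [← integral_Ioc_eq_integral_Ioo,
        ← intervalIntegral.integral_of_le (by linarith [Real.pi_pos])]
      have h1 := hper.intervalIntegral_add_eq (-π) 0
      rw [zero_add, show -π + 2 * π = π by ring] at h1
      rw [h1, intervalIntegral.integral_sub intervalIntegrable_const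
        (circleIntegrable_log_norm_entire hg z r), Real.circleAverage_def]
      simp only [intervalIntegral.integral_const, sub_zero, smul_eq_mul]
      field_simp
    · rw [intervalIntegrable_iff_integrableOn_Ioo_of_le (by linarith [Real.pi_pos])] at hci'
      exact hci'
    · exact Eventually.of_forall fun θ => sub_nonneg.2 (hM _ (hin θ))
  · have hin (θ : ℝ) : circleMap z r θ ∉ ball z S := by
      rw [mem_ball_iff_norm, circleMap_sub_center, norm_circleMap_zero, abs_of_pos hr0]
      exact hrS
    simp only [indicator_of_notMem (hin _), indicator_of_notMem (show r ∉ Iio S from hrS)]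
    simp

theorem lintegral_Ioo_ofReal_mul {S c : ℝ} (hS : 0 ≤ S) (hc : 0 ≤ c) :
    ∫⁻ r in Ioo 0 S, ENNReal.ofReal (r * (2 * π * c)) = ENNReal.ofReal (π * S ^ 2 * c) := by
  rw [← ofReal_integral_eq_lintegral_ofReal]
  · congr 1
    rw [← integral_Ioc_eq_integral_Ioo, ← intervalIntegral.integral_of_le hS,
      intervalIntegral.integral_mul_const, integral_id]
    ring
  · have : Continuous fun r : ℝ => r * (2 * π * c) := by fun_prop
    exact (this.integrableOn_Icc (a := 0) (b := S)).mono_set Ioo_subset_Icc_self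
  · refine (ae_restrict_mem measurableSet_Ioo).mono fun r hr => ?_
    have := hr.1.le
    positivity

/-- Sub-mean value property over discs. -/
theorem lintegral_ball_sub_log_norm_le (hg : Differentiable ℂ g) {z : ℂ} (hz : g z ≠ 0) {S M : ℝ}
    (hS : 0 < S) (hM : ∀ w ∈ ball z S, Real.log ‖g w‖ ≤ M) :
    ∫⁻ w in ball z S, ENNReal.ofReal (M - Real.log ‖g w‖) ≤
      ENNReal.ofReal (π * S ^ 2 * (M - Real.log ‖g z‖)) := by
  rw [lintegral_ball_sub_log_norm hg z hM, ← lintegral_Ioo_ofReal_mul hS.le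
    (sub_nonneg.2 (hM z (mem_ball_self hS)))]
  refine setLIntegral_mono' measurableSet_Ioo fun r hr => ENNReal.ofReal_le_ofReal ?_
  have := log_norm_le_circleAverage hg hz hr.1
  have := hr.1.le
  gcongr

/-- Circle averages of `log |g|` about a point increase with the radius, so the average over a disc
is at most that over its boundary. -/
theorem ofReal_sub_circleAverage_le_lintegral (hg : Differentiable ℂ g) {z : ℂ} (hz : g z ≠ 0)
    {S M : ℝ} (hS : 0 < S) (hM : ∀ w ∈ ball z S, Real.log ‖g w‖ ≤ M) :
    ENNReal.ofReal (π * S ^ 2 * (M - Real.circleAverage (fun w => Real.log ‖g w‖) z S)) ≤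
      ∫⁻ w in ball z S, ENNReal.ofReal (M - Real.log ‖g w‖) := by
  rcases le_or_gt 0 (M - Real.circleAverage (fun w => Real.log ‖g w‖) z S) with hc | hc
  · rw [lintegral_ball_sub_log_norm hg z hM, ← lintegral_Ioo_ofReal_mul hS.le hc]
    refine setLIntegral_mono' measurableSet_Ioo fun r hr => ENNReal.ofReal_le_ofReal ?_
    have := circleAverage_log_norm_mono hg hz hr.1 hr.2.le
    have := hr.1.le
    gcongr
  · rw [ENNReal.ofReal_of_nonpos (mul_nonpos_of_nonneg_of_nonpos (by positivity) hc.le)]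
    exact zero_le

/-- Since circle averages about a point `z₀` with `g z₀ ≠ 0` are bounded below, `log |g|` is
integrable on discs about `z₀`. -/
theorem locallyIntegrable_log_norm (hg : Differentiable ℂ g) {z₀ : ℂ} (h₀ : g z₀ ≠ 0) :
    LocallyIntegrable (fun w => Real.log ‖g w‖) := by
  have hmeas := measurable_log_norm_entire hg
  have key (S : ℝ) (hS : 0 < S) : IntegrableOn (fun w => Real.log ‖g w‖) (ball z₀ S) := by
    obtain ⟨C, hC⟩ := ((isCompact_closedBall z₀ S).image hg.continuous.norm).bddAbove
    set M := Real.log (max C 1) with hMdef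
    have hM0 : 0 ≤ M := Real.log_nonneg (le_max_right _ _)
    have hM : ∀ w ∈ ball z₀ S, Real.log ‖g w‖ ≤ M := by
      intro w hw
      rcases eq_or_ne (g w) 0 with h | h
      · rw [h, norm_zero, Real.log_zero]; exact hM0
      · exact Real.log_le_log (norm_pos_iff.2 h)
          ((hC (mem_image_of_mem _ (ball_subset_closedBall hw))).trans (le_max_left _ _))
    have h1 : IntegrableOn (fun w => M - Real.log ‖g w‖) (ball z₀ S) := by
      refine ⟨(measurable_const.sub hmeas).aestronglyMeasurable, ?_⟩
      rw [hasFiniteIntegral_iff_ofReal ((ae_restrict_mem measurableSet_ball).mono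
        fun w hw => sub_nonneg.2 (hM w hw))]
      exact (lintegral_ball_sub_log_norm_le hg h₀ hS hM).trans_lt ENNReal.ofReal_lt_top
    have h2 : IntegrableOn (fun _ : ℂ => M) (ball z₀ S) :=
      integrableOn_const measure_ball_lt_top.ne
    refine (h2.sub h1).congr (Eventually.of_forall fun w => ?_)
    simp
  intro w
  exact ⟨ball z₀ (dist w z₀ + 1), isOpen_ball.mem_nhds (mem_ball.2 (by linarith)),
    key _ (by positivity)⟩

end Entire

/-! ### Convergence of the rescaled logarithms -/

section Growth

open Metric EntireGrowth

theorem ofReal_pi_mul_sq {s : ℝ} (z : ℂ) :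
    volume (ball z s) = ENNReal.ofReal s ^ 2 * ENNReal.ofReal π := by
  rw [Complex.volume_ball, ← ENNReal.ofReal_coe_nnreal, NNReal.coe_real_pi]

theorem volume_ball_complex {s : ℝ} (hs : 0 ≤ s) (z : ℂ) :
    volume (ball z s) = ENNReal.ofReal (π * s ^ 2) := by
  rw [ofReal_pi_mul_sq, mul_comm, ENNReal.ofReal_mul Real.pi_pos.le, ENNReal.ofReal_pow hs]

variable {f : ℂ → ℂ}

theorem log_norm_le_norm (hle : ∀ z, ‖f z‖ ≤ Real.exp ‖z‖) (z : ℂ) : Real.log ‖f z‖ ≤ ‖z‖ := by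
  rcases eq_or_ne (f z) 0 with h | h
  · rw [h, norm_zero, Real.log_zero]; exact norm_nonneg z
  · rw [Real.log_le_iff_le_exp (norm_pos_iff.2 h)]; exact hle z

/-- Near every point, including the points close to the origin, `log |f|` comes close to its upper
bound `|z|`. -/
theorem exists_near_large (h0 : f 0 = 1) (hL : HasLargeValues f) {ε : ℝ} (hε : 0 < ε) :
    ∃ R : ℝ, 0 < R ∧ ∀ (z : ℂ) (s : ℝ), R ≤ s → ε * ‖z‖ ≤ s →
      ∃ z₁, f z₁ ≠ 0 ∧ ‖z₁ - z‖ ≤ s ∧ ‖z‖ - s ≤ Real.log ‖f z₁‖ := by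
  obtain ⟨R, hR⟩ := hL ε hε
  refine ⟨max R 1, by positivity, fun z s hs hεs => ?_⟩
  rcases le_total R ‖z‖ with h | h
  · obtain ⟨z₁, h1, h2⟩ := hR z h
    have hpos : 0 < ‖f z₁‖ := (Real.exp_pos _).trans_le h2
    refine ⟨z₁, norm_pos_iff.1 hpos, h1.trans hεs, ?_⟩
    have := (Real.le_log_iff_exp_le hpos).2 h2
    linarith
  · refine ⟨0, by simp [h0], ?_, ?_⟩
    · rw [zero_sub, norm_neg]; exact h.trans ((le_max_left _ _).trans hs)
    · rw [h0, norm_one, Real.log_one]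
      linarith [(le_max_left R 1).trans hs]

/-- The mean of `|z| + 3s - log |f|` over a disc of radius `s` is of the order of `s`: this is the
sub-mean value property about a nearby point where `log |f|` is almost `|z|`. -/
theorem lintegral_ball_defect_le (hd : Differentiable ℂ f) (hle : ∀ z, ‖f z‖ ≤ Real.exp ‖z‖)
    (h0 : f 0 = 1) (hL : HasLargeValues f) {ε : ℝ} (hε : 0 < ε) :
    ∃ R : ℝ, 0 < R ∧ ∀ (z : ℂ) (s : ℝ), R ≤ s → ε * ‖z‖ ≤ s →
      ∫⁻ w in ball z s, ENNReal.ofReal (‖z‖ + 3 * s - Real.log ‖f w‖) ≤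
        ENNReal.ofReal (16 * π * s ^ 3) := by
  obtain ⟨R, hR0, hR⟩ := exists_near_large h0 hL hε
  refine ⟨R, hR0, fun z s hs hεs => ?_⟩
  have hs0 : 0 < s := hR0.trans_le hs
  obtain ⟨z₁, h1, h2, h3⟩ := hR z s hs hεs
  have hsub : ball z s ⊆ ball z₁ (2 * s) := by
    apply ball_subset_ball'
    rw [dist_comm, dist_eq_norm]; linarith
  have hM : ∀ w ∈ ball z₁ (2 * s), Real.log ‖f w‖ ≤ ‖z‖ + 3 * s := by
    intro w hw
    refine (log_norm_le_norm hle w).trans ?_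
    rw [mem_ball_iff_norm] at hw
    have e1 : ‖w‖ ≤ ‖w - z₁‖ + ‖z₁ - z‖ + ‖z‖ := by
      calc ‖w‖ = ‖(w - z₁) + (z₁ - z) + z‖ := by congr 1; ring
        _ ≤ _ := norm_add₃_le
    linarith
  calc _ ≤ ∫⁻ w in ball z₁ (2 * s), ENNReal.ofReal (‖z‖ + 3 * s - Real.log ‖f w‖) :=
        lintegral_mono_set hsub
    _ ≤ _ := lintegral_ball_sub_log_norm_le hd h1 (by positivity) hM
    _ ≤ _ := by
        apply ENNReal.ofReal_le_ofReal
        have : ‖z‖ + 3 * s - Real.log ‖f z₁‖ ≤ 4 * s := by linarith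
        calc π * (2 * s) ^ 2 * (‖z‖ + 3 * s - Real.log ‖f z₁‖) ≤ π * (2 * s) ^ 2 * (4 * s) := by
              gcongr
          _ = _ := by ring

theorem circleAverage_log_norm_ge (hd : Differentiable ℂ f) (hle : ∀ z, ‖f z‖ ≤ Real.exp ‖z‖)
    (h0 : f 0 = 1) (hL : HasLargeValues f) {ε : ℝ} (hε : 0 < ε) :
    ∃ R : ℝ, 0 < R ∧ ∀ (z : ℂ) (s : ℝ), R ≤ s → ε * ‖z‖ ≤ s → f z ≠ 0 →
      ‖z‖ - 13 * s ≤ Real.circleAverage (fun w => Real.log ‖f w‖) z s := by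
  obtain ⟨R, hR0, hR⟩ := lintegral_ball_defect_le hd hle h0 hL hε
  refine ⟨R, hR0, fun z s hs hεs hz => ?_⟩
  have hs0 : 0 < s := hR0.trans_le hs
  have h1 := (ofReal_sub_circleAverage_le_lintegral hd hz hs0 (M := ‖z‖ + 3 * s)
    (fun w hw => by
      refine (log_norm_le_norm hle w).trans ?_
      rw [mem_ball_iff_norm] at hw
      have := norm_sub_norm_le w z
      linarith)).trans (hR z s hs hεs)
  rw [ENNReal.ofReal_le_ofReal_iff (by positivity)] at h1
  have h2 : ‖z‖ + 3 * s - Real.circleAverage (fun w => Real.log ‖f w‖) z s ≤ 16 * s := by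
    have hp : 0 < π * s ^ 2 := by positivity
    refine le_of_mul_le_mul_left (h1.trans (le_of_eq ?_)) hp
    ring
  linarith

/-- The local estimates over discs of radius `σ T`, averaged over the centres of these discs, show
that `|w| - log |f w|` is small in mean. -/
theorem lintegral_defect_le (hd : Differentiable ℂ f) (hle : ∀ z, ‖f z‖ ≤ Real.exp ‖z‖)
    (h0 : f 0 = 1) (hL : HasLargeValues f) {ε : ℝ} (hε : 0 < ε) :
    ∃ T₀ : ℝ, 0 < T₀ ∧ ∀ T, T₀ ≤ T →
      ∫⁻ w in ball (0 : ℂ) T, ENNReal.ofReal (‖w‖ - Real.log ‖f w‖) ≤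
        ENNReal.ofReal (ε * T ^ 3) := by
  have hmeas := measurable_log_norm_entire hd
  set σ := min 1 (ε / (64 * π)) with hσ
  have hσ0 : 0 < σ := by positivity
  have hσ1 : σ ≤ 1 := min_le_left _ _
  have hσε : 64 * π * σ ≤ ε := by
    have := min_le_right 1 (ε / (64 * π))
    rw [← hσ, le_div_iff₀ (by positivity)] at this
    linarith
  obtain ⟨R, hR0, hR⟩ := lintegral_ball_defect_le hd hle h0 hL (ε := σ / 2) (by positivity)
  refine ⟨R / σ, by positivity, fun T hT => ?_⟩
  have hT0 : 0 < T := lt_of_lt_of_le (by positivity) hT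
  set s := σ * T with hs
  have hRs : R ≤ s := by rw [div_le_iff₀ hσ0] at hT; linarith
  have hs0 : 0 < s := by positivity
  have hsT : s ≤ T := by rw [hs]; nlinarith
  set V : ℂ → ℝ≥0∞ := fun w => ENNReal.ofReal (‖w‖ - Real.log ‖f w‖) with hV
  have hVm : Measurable V := by fun_prop
  -- Integrate `V w` over the pairs `(z, w)` at distance less than `s`, in both orders.
  set D : Set (ℂ × ℂ) := {p | dist p.2 p.1 < s} with hD
  have hDm : MeasurableSet D :=
    measurableSet_lt (by fun_prop) measurable_const
  have hupper : ∫⁻ z in ball (0 : ℂ) (2 * T), ∫⁻ w, D.indicator (fun p => V p.2) (z, w) ≤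
      ENNReal.ofReal (16 * π * s ^ 3) * ENNReal.ofReal (π * (2 * T) ^ 2) := by
    rw [← volume_ball_complex (by positivity) 0, ← setLIntegral_const]
    refine setLIntegral_mono' measurableSet_ball fun z hz => ?_
    rw [mem_ball_zero_iff] at hz
    have e : (fun w => D.indicator (fun p => V p.2) (z, w)) = (ball z s).indicator V := rfl
    rw [e, lintegral_indicator measurableSet_ball]
    refine le_trans (setLIntegral_mono' measurableSet_ball fun w hw => ?_)
      (hR z s hRs (by rw [hs]; nlinarith))
    apply ENNReal.ofReal_le_ofReal
    rw [mem_ball_iff_norm] at hw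
    have := norm_sub_norm_le w z
    linarith
  have hlower : ENNReal.ofReal (π * s ^ 2) * ∫⁻ w in ball (0 : ℂ) T, V w ≤
      ∫⁻ z in ball (0 : ℂ) (2 * T), ∫⁻ w, D.indicator (fun p => V p.2) (z, w) := by
    rw [lintegral_lintegral_swap (f := fun z w => D.indicator (fun p => V p.2) (z, w))
      ((hVm.comp measurable_snd).indicator hDm).aemeasurable, ← lintegral_const_mul _ hVm]
    refine le_trans (setLIntegral_mono' measurableSet_ball fun w hw => ?_)
      (setLIntegral_le_lintegral (ball (0 : ℂ) T) _)
    rw [mem_ball_zero_iff] at hw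
    have hsub : ball w s ⊆ ball 0 (2 * T) := by
      apply ball_subset_ball'
      rw [dist_zero_right]; linarith
    have e : (fun z => D.indicator (fun p => V p.2) (z, w)) =
        (ball w s).indicator (fun _ => V w) := by
      ext z
      simp only [indicator, hD, mem_ofPred_eq, mem_ball, dist_comm w z]
    rw [e, lintegral_indicator measurableSet_ball, setLIntegral_const,
      Measure.restrict_apply measurableSet_ball, inter_eq_left.2 hsub,
      volume_ball_complex hs0.le, mul_comm]
  have h := hlower.trans hupper
  rw [← ENNReal.ofReal_mul (by positivity)] at h
  have hp : 0 < π * s ^ 2 := by positivity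
  have h2 : 16 * π * s ^ 3 * (π * (2 * T) ^ 2) ≤ π * s ^ 2 * (ε * T ^ 3) := by
    calc 16 * π * s ^ 3 * (π * (2 * T) ^ 2) = π * s ^ 2 * ((64 * π * σ) * T ^ 3) := by
          rw [hs]; ring
      _ ≤ _ := by gcongr
  have h3 := h.trans (ENNReal.ofReal_le_ofReal h2)
  rw [ENNReal.ofReal_mul hp.le] at h3
  exact (ENNReal.mul_le_mul_iff_right (ENNReal.ofReal_pos.2 hp).ne' ENNReal.ofReal_ne_top).1 h3

theorem differentiable_comp_mul (hd : Differentiable ℂ f) (c : ℂ) :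
    Differentiable ℂ fun z => f (c * z) :=
  hd.comp (differentiable_id.const_mul c)

/-- `t⁻¹ log |f (t z)|` converges to `|z|` weakly against continuous functions of compact
support. -/
theorem tendsto_integral_rescale_log_norm (hd : Differentiable ℂ f)
    (hle : ∀ z, ‖f z‖ ≤ Real.exp ‖z‖) (h0 : f 0 = 1) (hL : HasLargeValues f) {ψ : ℂ → ℝ}
    (hψ : Continuous ψ) (hψc : HasCompactSupport ψ) :
    Tendsto (fun t : ℝ => ∫ z : ℂ, rescale 1 t (fun w => Real.log ‖f w‖) z * ψ z) atTop
      (𝓝 (∫ z : ℂ, ‖z‖ * ψ z)) := by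
  obtain ⟨C, hC⟩ := hψc.exists_bound_of_continuous hψ
  have hC0 : 0 ≤ C := (norm_nonneg _).trans (hC 0)
  obtain ⟨S, hS0, hS⟩ : ∃ S : ℝ, 0 < S ∧ ∀ z, ψ z ≠ 0 → ‖z‖ < S := by
    obtain ⟨S, hS⟩ := hψc.isBounded.subset_ball 0
    refine ⟨max S 1, by positivity, fun z hz => ?_⟩
    have := hS (subset_tsupport _ hz)
    rw [mem_ball_zero_iff] at this
    exact this.trans_le (le_max_left _ _)
  have hint1 : Integrable fun z : ℂ => ‖z‖ * ψ z :=
    (continuous_norm.mul hψ).integrable_of_hasCompactSupport hψc.mul_left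
  have hint2 (t : ℝ) : Integrable fun z : ℂ => rescale 1 t (fun w => Real.log ‖f w‖) z * ψ z := by
    have h1 := (locallyIntegrable_log_norm (differentiable_comp_mul hd (t : ℂ)) (z₀ := 0)
      (by simp [h0])).integrable_smul_right_of_hasCompactSupport hψ hψc
    refine (h1.const_mul (t ^ (-1 : ℝ))).congr (Eventually.of_forall fun z => ?_)
    simp only [rescale, smul_eq_mul]
    ring
  rw [tendsto_iff_norm_sub_tendsto_zero]
  rw [Metric.tendsto_atTop]
  intro ε hε
  set δ := ε / (2 * ((C + 1) * S ^ 3)) with hδ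
  have hδ0 : 0 < δ := by positivity
  obtain ⟨T₀, hT0, hT⟩ := lintegral_defect_le hd hle h0 hL hδ0
  refine ⟨max 1 (T₀ / S), fun t ht => ?_⟩
  have ht0 : 0 < t := lt_of_lt_of_le one_pos ((le_max_left _ _).trans ht)
  have htS : T₀ ≤ t * S := by
    have := (le_max_right _ _).trans ht
    rwa [div_le_iff₀ hS0] at this
  set h : ℂ → ℝ := fun w => (Real.log ‖f w‖ - ‖w‖) * ψ (t⁻¹ • w) with hh
  have hmeas := measurable_log_norm_entire hd
  have e1 : (∫ z : ℂ, rescale 1 t (fun w => Real.log ‖f w‖) z * ψ z) - ∫ z : ℂ, ‖z‖ * ψ z =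
      t⁻¹ * (|(t ^ 2)⁻¹| * ∫ w, h w) := by
    rw [← integral_sub (hint2 t) hint1]
    have := Measure.integral_comp_smul (volume : Measure ℂ) h t
    rw [Complex.finrank_real_complex, smul_eq_mul] at this
    rw [← this, ← integral_const_mul]
    refine integral_congr_ae (Eventually.of_forall fun z => ?_)
    have h1 : t⁻¹ • t • z = z := by rw [smul_smul, inv_mul_cancel₀ ht0.ne', one_smul]
    have h2 : ‖t • z‖ = t * ‖z‖ := by rw [norm_smul, Real.norm_eq_abs, abs_of_pos ht0]
    simp only [hh, rescale]
    rw [h1, h2, Real.rpow_neg_one, Complex.real_smul]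
    field_simp
  have hbound : ∫⁻ w, ‖h w‖ₑ ≤ ENNReal.ofReal (C * (δ * (t * S) ^ 3)) := by
    calc ∫⁻ w, ‖h w‖ₑ ≤ ∫⁻ w, (ball (0 : ℂ) (t * S)).indicator
          (fun w => ENNReal.ofReal C * ENNReal.ofReal (‖w‖ - Real.log ‖f w‖)) w := by
          refine lintegral_mono fun w => ?_
          by_cases hw : ψ (t⁻¹ • w) = 0
          · rw [hh]
            simp only [hw, mul_zero, enorm_zero, zero_le]
          · have hwS : w ∈ ball (0 : ℂ) (t * S) := by
              have := hS _ hw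
              rw [norm_smul, norm_inv, Real.norm_eq_abs, abs_of_pos ht0,
                inv_mul_lt_iff₀ ht0] at this
              simpa using this
            rw [indicator_of_mem hwS, ← ENNReal.ofReal_mul hC0, ← ofReal_norm]
            apply ENNReal.ofReal_le_ofReal
            rw [hh, norm_mul, mul_comm, Real.norm_eq_abs (_ - _), abs_sub_comm,
              abs_of_nonneg (sub_nonneg.2 (log_norm_le_norm hle w))]
            exact mul_le_mul_of_nonneg_right (hC _) (sub_nonneg.2 (log_norm_le_norm hle w))
      _ = ENNReal.ofReal C * ∫⁻ w in ball (0 : ℂ) (t * S),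
            ENNReal.ofReal (‖w‖ - Real.log ‖f w‖) := by
          rw [lintegral_indicator measurableSet_ball, lintegral_const_mul _ (by fun_prop)]
      _ ≤ _ := by
          rw [ENNReal.ofReal_mul hC0]
          gcongr
          exact hT _ htS
  have hbound' : ‖∫ w, h w‖ ≤ C * (δ * (t * S) ^ 3) := by
    refine (norm_integral_le_lintegral_norm _).trans ?_
    refine ENNReal.toReal_le_of_le_ofReal (by positivity) ?_
    simpa only [ofReal_norm] using hbound
  rw [e1, dist_zero_right, norm_norm, norm_mul, norm_mul, Real.norm_eq_abs, Real.norm_eq_abs,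
    abs_abs, abs_of_pos (inv_pos.2 ht0), abs_of_pos (inv_pos.2 (pow_pos ht0 2))]
  calc t⁻¹ * ((t ^ 2)⁻¹ * ‖∫ w, h w‖) ≤ t⁻¹ * ((t ^ 2)⁻¹ * (C * (δ * (t * S) ^ 3))) := by gcongr
    _ = C / (C + 1) * (ε / 2) := by rw [hδ]; field_simp
    _ ≤ 1 * (ε / 2) := by
        gcongr
        rw [div_le_one (by positivity)]
        linarith
    _ < ε := by linarith

theorem zeroMeasure_closedBall_zero_le (hd : Differentiable ℂ f) (hle : ∀ z, ‖f z‖ ≤ Real.exp ‖z‖)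
    (h0 : f 0 = 1) {r : ℝ} (hr : 0 < r) :
    zeroMeasure f (closedBall 0 r) ≤ ENNReal.ofReal (4 * r) := by
  have h := zeroMeasure_closedBall_le hd (z := 0) (by simp [h0]) (M := 2 * r) hr (fun w hw => by
    refine (log_norm_le_norm hle w).trans ?_
    rw [mem_sphere_zero_iff_norm] at hw
    exact hw.le)
  rw [h0, norm_one, Real.log_one, sub_zero] at h
  have hlog : (1 / 2 : ℝ) ≤ Real.log 2 := by linarith [Real.log_two_gt_d9]
  have h2 : ENNReal.ofReal (1 / 2) * zeroMeasure f (closedBall 0 r) ≤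
      ENNReal.ofReal (1 / 2) * ENNReal.ofReal (4 * r) := by
    rw [← ENNReal.ofReal_mul (by norm_num)]
    refine le_trans (by gcongr) (h.trans (ENNReal.ofReal_le_ofReal (by linarith)))
  exact (ENNReal.mul_le_mul_iff_right (by simp) ENNReal.ofReal_ne_top).1 h2

theorem norm_le_maxModulus (hle : ∀ z, ‖f z‖ ≤ Real.exp ‖z‖) (z : ℂ) :
    ‖f z‖ ≤ maxModulus f ‖z‖ := by
  have hb : BddAbove (range fun θ : ℝ => ‖f (‖z‖ * Complex.exp (θ * Complex.I))‖) := by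
    refine ⟨Real.exp ‖z‖, ?_⟩
    rintro _ ⟨θ, rfl⟩
    refine (hle _).trans (le_of_eq ?_)
    simp [Complex.norm_exp_ofReal_mul_I]
  have := le_ciSup hb (Complex.arg z)
  rwa [Complex.norm_mul_exp_arg_mul_I] at this

theorem maxModulus_le (hle : ∀ z, ‖f z‖ ≤ Real.exp ‖z‖) {r : ℝ} (hr : 0 ≤ r) :
    maxModulus f r ≤ Real.exp r := by
  refine ciSup_le fun θ => (hle _).trans (le_of_eq ?_)
  simp [Complex.norm_exp_ofReal_mul_I, abs_of_nonneg hr]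

theorem tendsto_log_maxModulus_div (hle : ∀ z, ‖f z‖ ≤ Real.exp ‖z‖)
    (hlow : ∀ l r : ℝ, 0 ≤ l → l < 1 → 0 < r → Real.exp (l * r) ≤ maxModulus f r / (1 - l)) :
    Tendsto (fun r : ℝ => Real.log (maxModulus f r) / r) atTop (𝓝 1) := by
  rw [tendsto_order]
  constructor
  · intro a ha
    set l := (max a 0 + 1) / 2 with hl
    have hm1 : max a 0 < 1 := max_lt ha one_pos
    have hm0 : 0 ≤ max a 0 := le_max_right _ _
    have hal : a < l := lt_of_le_of_lt (le_max_left a 0) (by linarith)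
    have hl1 : l < 1 := by linarith
    have hlim : Tendsto (fun r : ℝ => l + Real.log (1 - l) / r) atTop (𝓝 (l + 0)) :=
      tendsto_const_nhds.add (tendsto_const_nhds.div_atTop tendsto_id)
    rw [add_zero] at hlim
    filter_upwards [hlim.eventually_const_lt hal, eventually_gt_atTop 0] with r hr hr0
    refine hr.trans_le ?_
    have h1 := hlow l r (by linarith) hl1 hr0
    rw [le_div_iff₀ (by linarith)] at h1
    have h2 := Real.log_le_log (mul_pos (Real.exp_pos _) (by linarith)) h1
    rw [Real.log_mul (Real.exp_pos _).ne' (by linarith), Real.log_exp] at h2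
    rw [le_div_iff₀ hr0]
    calc (l + Real.log (1 - l) / r) * r = l * r + Real.log (1 - l) := by field_simp
      _ ≤ _ := h2
  · intro a ha
    filter_upwards [eventually_gt_atTop 0] with r hr0
    refine lt_of_le_of_lt ?_ ha
    have h1 := hlow 0 r le_rfl one_pos hr0
    rw [zero_mul, Real.exp_zero, sub_zero, div_one] at h1
    rw [div_le_one hr0, Real.log_le_iff_le_exp (one_pos.trans_le h1)]
    exact maxModulus_le hle hr0.le

theorem typeOfOrder_eq_one
    (h : Tendsto (fun r : ℝ => Real.log (maxModulus f r) / r) atTop (𝓝 1)) :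
    typeOfOrder 1 f = 1 := by
  have h1 := (continuous_coe_real_ereal.tendsto 1).comp h
  rw [typeOfOrder, ← EReal.coe_one, ← h1.limsup_eq]
  refine limsup_congr (Eventually.of_forall fun r => ?_)
  rw [Function.comp_apply, Real.rpow_neg_one, mul_comm, div_eq_mul_inv]

theorem order_eq_one
    (h : Tendsto (fun r : ℝ => Real.log (maxModulus f r) / r) atTop (𝓝 1)) :
    order f = 1 := by
  have h1 : Tendsto (fun r : ℝ => Real.log (Real.log (maxModulus f r) / r) / Real.log r + 1) atTop
      (𝓝 (0 + 1)) := by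
    refine Tendsto.add ?_ tendsto_const_nhds
    have := (Real.continuousAt_log one_ne_zero).tendsto.comp h
    exact this.div_atTop Real.tendsto_log_atTop
  rw [zero_add] at h1
  have h2 := (continuous_coe_real_ereal.tendsto 1).comp h1
  rw [order, ← EReal.coe_one, ← h2.limsup_eq]
  refine limsup_congr ?_
  filter_upwards [eventually_gt_atTop 1, h.eventually_const_lt one_half_lt_one] with r hr hr2
  rw [Function.comp_apply]
  congr 1
  have hlr : 0 < Real.log r := Real.log_pos hr
  have hr0 : 0 < r := by linarith
  have hM : Real.log (maxModulus f r) ≠ 0 := by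
    intro hz
    rw [hz, zero_div] at hr2
    norm_num at hr2
  rw [Real.log_div hM hr0.ne']
  field_simp
  ring

theorem completelyRegularGrowth_of_hasLargeValues (hd : Differentiable ℂ f)
    (hle : ∀ z, ‖f z‖ ≤ Real.exp ‖z‖) (h0 : f 0 = 1) (hL : HasLargeValues f)
    (hlow : ∀ l r : ℝ, 0 ≤ l → l < 1 → 0 < r → Real.exp (l * r) ≤ maxModulus f r / (1 - l)) :
    CompletelyRegularGrowth 1 f := by
  have hlim := tendsto_log_maxModulus_div hle hlow
  refine ⟨hd, by rw [order_eq_one hlim, EReal.coe_one], ?_, ?_, ?_⟩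
  · rw [typeOfOrder_eq_one hlim]; exact zero_lt_one
  · rw [typeOfOrder_eq_one hlim]; exact EReal.coe_lt_top 1
  · have hloc : LocallyIntegrableOn (fun z : ℂ => ‖z‖) ((⊤ : Opens ℂ) : Set ℂ) :=
      continuous_norm.locallyIntegrable.locallyIntegrableOn _
    refine ⟨TestFunction.integralAgainstBilinCLM (ContinuousLinearMap.mul ℝ ℝ) volume
      (fun z : ℂ => ‖z‖), fun χ => ?_⟩
    have h1 := tendsto_integral_rescale_log_norm hd hle h0 hL χ.continuous χ.hasCompactSupport
    refine (h1.congr fun t => rfl).trans (le_of_eq ?_)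
    congr 1
    refine Eq.trans (integral_congr_ae (Eventually.of_forall fun z => ?_))
      (TestFunction.integralAgainstBilinCLM_eq_integral hloc).symm
    simp [mul_comm]

end Growth

/-! ### The exceptional set -/

section Exceptional

open Metric EntireGrowth

/-- A point around which a measure has mass at most `K (r / H) ^ η` in the discs of radii
`r = H / 2 ^ j` has logarithmic potential at most a multiple of `K`; here `x = 2 ^ (-η)`. -/
theorem lintegral_posLog_le_of_measure_closedBall_le {μ : Measure ℂ} {z : ℂ} {H K x : ℝ}
    (hH : 0 < H) (hK : 0 ≤ K) (hx0 : 0 ≤ x) (hx1 : x < 1)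
    (h : ∀ j : ℕ, μ (closedBall z (H / 2 ^ j)) ≤ ENNReal.ofReal (K * x ^ j)) :
    ∫⁻ a, ENNReal.ofReal (Real.posLog (H / ‖z - a‖)) ∂μ ≤
      ENNReal.ofReal (Real.log 2 * K / (1 - x)) := by
  have hlog2 : 0 ≤ Real.log 2 := Real.log_nonneg (by norm_num)
  have hpt (a : ℂ) : ENNReal.ofReal (Real.posLog (H / ‖z - a‖)) ≤
      ∑' j : ℕ, (closedBall z (H / 2 ^ j)).indicator (fun _ => ENNReal.ofReal (Real.log 2)) a := by
    rcases lt_or_ge (H / ‖z - a‖) 1 with h1 | h1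
    · rw [(Real.posLog_eq_zero_iff _).2 (by rw [abs_of_nonneg (by positivity)]; exact h1.le)]
      simp
    · have hd : 0 < ‖z - a‖ := by
        by_contra hn
        have : ‖z - a‖ = 0 := le_antisymm (not_lt.1 hn) (norm_nonneg _)
        rw [this, div_zero] at h1
        linarith
      obtain ⟨m, hm1, hm2⟩ := exists_nat_pow_near h1 (one_lt_two : (1 : ℝ) < 2)
      have h2 : Real.posLog (H / ‖z - a‖) ≤ (m + 1 : ℕ) * Real.log 2 := by
        rw [Real.posLog_eq_log (by rwa [abs_of_nonneg (by positivity)]), ← Real.log_pow]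
        exact Real.log_le_log (by positivity) hm2.le
      refine (ENNReal.ofReal_le_ofReal h2).trans ?_
      refine le_trans ?_ (ENNReal.sum_le_tsum (Finset.range (m + 1)))
      rw [Finset.sum_congr rfl (g := fun _ => ENNReal.ofReal (Real.log 2))]
      · rw [Finset.sum_const, Finset.card_range, nsmul_eq_mul, ENNReal.ofReal_mul (by positivity),
          ENNReal.ofReal_natCast]
      · intro j hj
        refine indicator_of_mem ?_ _
        rw [mem_closedBall_iff_norm, norm_sub_rev, le_div_iff₀ (by positivity), mul_comm,
          ← le_div_iff₀ hd]
        refine le_trans ?_ hm1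
        exact pow_le_pow_right₀ one_le_two (Nat.lt_succ_iff.1 (Finset.mem_range.1 hj))
  have hgeo := ((hasSum_geometric_of_lt_one hx0 hx1).mul_left (Real.log 2 * K))
  calc ∫⁻ a, ENNReal.ofReal (Real.posLog (H / ‖z - a‖)) ∂μ
      ≤ ∫⁻ a, ∑' j : ℕ, (closedBall z (H / 2 ^ j)).indicator
          (fun _ => ENNReal.ofReal (Real.log 2)) a ∂μ := lintegral_mono hpt
    _ = ∑' j : ℕ, ENNReal.ofReal (Real.log 2) * μ (closedBall z (H / 2 ^ j)) := by
        rw [lintegral_tsum fun j =>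
          (measurable_const.indicator measurableSet_closedBall).aemeasurable]
        simp only [lintegral_indicator measurableSet_closedBall, setLIntegral_const]
    _ ≤ ∑' j : ℕ, ENNReal.ofReal (Real.log 2 * K * x ^ j) := by
        refine ENNReal.tsum_le_tsum fun j => ?_
        rw [mul_assoc, ENNReal.ofReal_mul hlog2]
        gcongr
        exact h j
    _ = ENNReal.ofReal (Real.log 2 * K / (1 - x)) := by
        rw [← ENNReal.ofReal_tsum_of_nonneg (fun j => by positivity) hgeo.summable, hgeo.tsum_eq,
          div_eq_mul_inv]

/-- Discs centred in the shell `2 ^ k ≤ |z| < 2 ^ (k + 1)` which cover the part of the shell where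
`f` vanishes or `log |f(z)|` differs from `|z|` by more than `ε |z|`, the sum of the `η`-th powers
of their radii being at most `ε 2 ^ (k η)`. The discs are indexed by their centres. -/
def HasShellCover (f : ℂ → ℂ) (ε η : ℝ) (k : ℕ) : Prop :=
  ∃ (u : Set ℂ) (r : ℂ → ℝ≥0), u.Countable ∧
    (∀ w ∈ u, (2 : ℝ) ^ k ≤ ‖w‖ ∧ ‖w‖ < 2 ^ (k + 1) ∧ (r w : ℝ) ≤ 2 ^ k) ∧
    ∑' w : u, (r w : ℝ≥0∞) ^ η ≤ ENNReal.ofReal (ε * ((2 : ℝ) ^ k) ^ η) ∧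
    ∀ z : ℂ, (2 : ℝ) ^ k ≤ ‖z‖ → ‖z‖ < 2 ^ (k + 1) → z ∉ ⋃ w ∈ u, ball w (r w) →
      f z ≠ 0 ∧ |Real.log ‖f z‖ - ‖z‖| ≤ ε * ‖z‖

variable {f : ℂ → ℂ}

theorem one_le_zeroMeasure_closedBall (hd : Differentiable ℂ f) {z : ℂ} (hz : f z = 0) {r : ℝ}
    (hr : 0 ≤ r) : 1 ≤ zeroMeasure f (closedBall z r) := by
  have h1 := Measure.le_iff.1 (Measure.le_sum
    (fun z : ℂ => (analyticOrderAt f z : ℝ≥0∞) • Measure.dirac z) z) _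
    (measurableSet_closedBall (x := z) (ε := r))
  refine le_trans ?_ h1
  rw [Measure.smul_apply, Measure.dirac_apply' _ measurableSet_closedBall,
    indicator_of_mem (mem_closedBall_self hr), Pi.one_apply, smul_eq_mul, mul_one]
  have : analyticOrderAt f z ≠ 0 := fun h => (hd.analyticAt z).analyticOrderAt_eq_zero.1 h hz
  exact_mod_cast Order.one_le_iff_ne_zero.2 this

/-- The argument of Cartan's lemma: the points around which the zeros accumulate too much are
covered by discs with small radii through Vitali's covering lemma, and elsewhere Jensen's formula
bounds `log |f|` from below. -/
theorem eventually_hasShellCover (hd : Differentiable ℂ f)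
    (hle : ∀ z, ‖f z‖ ≤ Real.exp ‖z‖) (h0 : f 0 = 1) (hL : HasLargeValues f) {ε η : ℝ}
    (hε : 0 < ε) (hη : 0 < η) : ∀ᶠ k : ℕ in atTop, HasShellCover f ε η k := by
  have hlog2 : 0 < Real.log 2 := Real.log_pos (by norm_num)
  set x : ℝ := (2 : ℝ) ^ (-η) with hx
  have hx0 : 0 < x := by positivity
  have hx1 : x < 1 := Real.rpow_lt_one_of_one_lt_of_neg one_lt_two (by linarith)
  have hx1' : 0 < 1 - x := by linarith
  -- Outside the discs, the potential of the zeros in a disc of radius `h 2 ^ k` is at most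
  -- `ε 2 ^ k / 2`; the conditions on `h` make the circle averages and the radii good enough.
  set κ : ℝ := ε * (1 - x) / (2 * Real.log 2) with hκ
  have hκ0 : 0 < κ := by positivity
  set h : ℝ := min (1 / 6) (min (ε / 26) ((ε * κ / 16) ^ (1 / η) / 6)) with hh
  have hh0 : 0 < h := by positivity
  have hh1 : h ≤ 1 / 6 := min_le_left _ _
  have hh2 : h ≤ ε / 26 := (min_le_right _ _).trans (min_le_left _ _)
  have hh3 : (6 * h) ^ η ≤ ε * κ / 16 := by
    have h1 : h ≤ (ε * κ / 16) ^ (1 / η) / 6 := (min_le_right _ _).trans (min_le_right _ _)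
    calc (6 * h) ^ η ≤ ((ε * κ / 16) ^ (1 / η)) ^ η := by
          apply Real.rpow_le_rpow (by positivity) (by linarith) hη.le
      _ = ε * κ / 16 := by
          rw [← Real.rpow_mul (by positivity), one_div_mul_cancel hη.ne', Real.rpow_one]
  obtain ⟨R, hR0, hR⟩ := circleAverage_log_norm_ge hd hle h0 hL (ε := h / 2) (by positivity)
  have hpow : Tendsto (fun k : ℕ => h * (2 : ℝ) ^ k) atTop atTop :=
    (tendsto_pow_atTop_atTop_of_one_lt one_lt_two).const_mul_atTop hh0
  filter_upwards [hpow.eventually_ge_atTop R] with k hk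
  set X : ℝ := 2 ^ k with hX
  have hX0 : 0 < X := by positivity
  have hX2 : (2 : ℝ) ^ (k + 1) = 2 * X := by rw [hX]; ring
  set H : ℝ := h * X with hH
  have hH0 : 0 < H := by positivity
  have hHX : 6 * H ≤ X := by rw [hH]; nlinarith
  set μ := zeroMeasure f with hμ
  -- The points of the shell around which the zeros accumulate too much on some scale `H / 2 ^ j`.
  set B : Set ℂ := {z | (X ≤ ‖z‖ ∧ ‖z‖ < 2 * X) ∧
    ∃ j : ℕ, ENNReal.ofReal (κ * X * x ^ j) < μ (closedBall z (H / 2 ^ j))} with hB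
  have hj : ∀ z : ℂ, ∃ j : ℕ, z ∈ B → ENNReal.ofReal (κ * X * x ^ j) <
      μ (closedBall z (H / 2 ^ j)) := by
    intro z
    by_cases hz : z ∈ B
    · obtain ⟨j, hj⟩ := hz.2
      exact ⟨j, fun _ => hj⟩
    · exact ⟨0, fun h => absurd h hz⟩
  choose j hj using hj
  have hrH (z : ℂ) : H / 2 ^ j z ≤ H := div_le_self hH0.le (one_le_pow₀ one_le_two)
  obtain ⟨u, huB, hdisj, hcov⟩ := Vitali.exists_disjoint_subfamily_covering_enlargement_closedBall
    B (fun z : ℂ => z) (fun z => H / 2 ^ j z) H (fun z _ => hrH z) 5 (by norm_num)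
  have hucount : u.Countable := by
    refine PairwiseDisjoint.countable_of_nonempty_interior hdisj fun w _ => ?_
    rw [interior_closedBall _ (by positivity)]
    exact nonempty_ball.2 (by positivity)
  refine ⟨u, fun w => Real.toNNReal (6 * (H / 2 ^ j w)), hucount, ?_, ?_, ?_⟩
  · intro w hw
    obtain ⟨⟨h1, h2⟩, -⟩ := huB hw
    refine ⟨h1, by rw [hX2]; exact h2, ?_⟩
    rw [Real.coe_toNNReal _ (by positivity)]
    linarith [hrH w]
  · -- The discs chosen by Vitali's lemma are disjoint, so their zeros number at most `16 X`.
    have hmass : ∑' w : u, ENNReal.ofReal (κ * X * x ^ j w) ≤ ENNReal.ofReal (16 * X) := by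
      calc ∑' w : u, ENNReal.ofReal (κ * X * x ^ j w)
          ≤ ∑' w : u, μ (closedBall (w : ℂ) (H / 2 ^ j w)) :=
            ENNReal.tsum_le_tsum fun w => (hj w (huB w.2)).le
        _ = μ (⋃ w ∈ u, closedBall w (H / 2 ^ j w)) :=
            (measure_biUnion hucount hdisj fun _ _ => measurableSet_closedBall).symm
        _ ≤ μ (closedBall 0 (4 * X)) := by
            refine measure_mono (iUnion₂_subset fun w hw => closedBall_subset_closedBall' ?_)
            rw [dist_zero_right]
            linarith [hrH w, (huB hw).1.2]
        _ ≤ ENNReal.ofReal (4 * (4 * X)) :=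
            zeroMeasure_closedBall_zero_le hd hle h0 (by positivity)
        _ = _ := by congr 1; ring
    have hterm (w : ℂ) : ((Real.toNNReal (6 * (H / 2 ^ j w)) : ℝ≥0) : ℝ≥0∞) ^ η =
        ENNReal.ofReal ((6 * H) ^ η / (κ * X)) * ENNReal.ofReal (κ * X * x ^ j w) := by
      rw [← ENNReal.ofReal_mul (by positivity), ← ENNReal.ofReal,
        ENNReal.ofReal_rpow_of_pos (by positivity)]
      congr 1
      have e1 : x ^ j w = ((2 ^ j w : ℝ) ^ η)⁻¹ := by
        rw [hx, ← Real.rpow_natCast, ← Real.rpow_mul (by norm_num), ← Real.rpow_natCast,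
          ← Real.rpow_mul (by norm_num), ← Real.rpow_neg (by norm_num)]
        congr 1; ring
      rw [e1, ← mul_div_assoc, Real.div_rpow (by positivity) (by positivity)]
      field_simp
    simp only [hterm]
    rw [ENNReal.tsum_mul_left]
    refine (mul_le_mul_right hmass _).trans ?_
    rw [← ENNReal.ofReal_mul (by positivity)]
    apply ENNReal.ofReal_le_ofReal
    calc (6 * H) ^ η / (κ * X) * (16 * X) = (6 * h) ^ η * X ^ η * 16 / κ := by
          rw [hH, ← mul_assoc 6 h X, Real.mul_rpow (by positivity) hX0.le]
          field_simp
      _ ≤ (ε * κ / 16) * X ^ η * 16 / κ := by gcongr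
      _ = ε * X ^ η := by field_simp
  · intro z hz1 hz2 hzu
    rw [hX2] at hz2
    have hzB : z ∉ B := by
      intro hzB
      obtain ⟨b, hbu, hb⟩ := hcov z hzB
      refine hzu (mem_iUnion₂.2 ⟨b, hbu, ?_⟩)
      have hmem := hb (mem_closedBall_self (by positivity))
      rw [Real.coe_toNNReal _ (by positivity)]
      refine closedBall_subset_ball ?_ hmem
      have : 0 < H / 2 ^ j b := by positivity
      linarith
    have hbound : ∀ i : ℕ, μ (closedBall z (H / 2 ^ i)) ≤ ENNReal.ofReal (κ * X * x ^ i) := by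
      intro i
      by_contra hcon
      exact hzB ⟨⟨hz1, hz2⟩, i, not_le.1 hcon⟩
    -- A zero has mass at least `1` on all scales, but the bounds tend to zero.
    have hfz : f z ≠ 0 := by
      intro hfz
      have hlim : Tendsto (fun i : ℕ => κ * X * x ^ i) atTop (𝓝 0) := by
        simpa using (tendsto_pow_atTop_nhds_zero_of_lt_one hx0.le hx1).const_mul (κ * X)
      obtain ⟨i, hi⟩ := (hlim.eventually_lt_const one_pos).exists
      have h1 := (one_le_zeroMeasure_closedBall hd hfz (by positivity)).trans (hbound i)
      rw [ENNReal.one_le_ofReal] at h1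
      linarith
    refine ⟨hfz, ?_⟩
    have hpot := lintegral_posLog_le_of_measure_closedBall_le hH0 (by positivity) hx0.le hx1 hbound
    rw [jensen_lintegral hd hfz hH0, ENNReal.ofReal_le_ofReal_iff (by positivity)] at hpot
    have e1 : Real.log 2 * (κ * X) / (1 - x) = ε * X / 2 := by rw [hκ]; field_simp
    rw [e1] at hpot
    have hav := hR z H hk (by rw [hH]; nlinarith) hfz
    have hup := log_norm_le_norm hle z
    have h13 : 13 * H ≤ ε * X / 2 := by rw [hH]; nlinarith
    rw [abs_sub_comm, abs_of_nonneg (by linarith)]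
    nlinarith

/-- Any countable family of discs may be used, since discs of radius `0` are empty and do not
contribute to the sums. -/
theorem isSmallExceptional_of_countable {ι : Type*} [Countable ι] {η : ℝ} (hη : 0 < η) {E : Set ℂ}
    (w : ι → ℂ) (s : ι → ℝ≥0) (hE : E ⊆ ⋃ i, ball (w i) (s i))
    (h : Tendsto (fun r : ℝ => (∑' i, if ‖w i‖ ≤ r then (s i : ℝ≥0∞) ^ η else 0) /
      ENNReal.ofReal (r ^ η)) atTop (𝓝 0)) : IsSmallExceptional η E := by
  obtain ⟨e, he⟩ := exists_injective_nat ι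
  refine ⟨Function.extend e w 0, Function.extend e s 0, fun z hz => ?_, ?_⟩
  · obtain ⟨i, hi⟩ := mem_iUnion.1 (hE hz)
    exact mem_iUnion.2 ⟨e i, by rwa [he.extend_apply, he.extend_apply]⟩
  · refine h.congr fun r => ?_
    congr 1
    rw [← tsum_extend_zero he]
    refine tsum_congr fun n => ?_
    by_cases hn : ∃ i, e i = n
    · obtain ⟨i, rfl⟩ := hn
      simp only [he.extend_apply]
    · simp [Function.extend_apply' _ _ _ hn, ENNReal.zero_rpow_of_pos hη]

theorem tsum_ite_two_pow_le {η : ℝ} (hη : 0 < η) : ∃ C : ℝ, 0 < C ∧ ∀ r : ℝ, 1 ≤ r →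
    ∑' k : ℕ, (if (2 : ℝ) ^ k ≤ r then ENNReal.ofReal (((2 : ℝ) ^ k) ^ η) else 0) ≤
      ENNReal.ofReal (C * r ^ η) := by
  set y : ℝ := 2 ^ η with hy
  have hy1 : 1 < y := Real.one_lt_rpow one_lt_two hη
  have hy1' : 0 < y - 1 := by linarith
  have hpow (k : ℕ) : ((2 : ℝ) ^ k) ^ η = y ^ k := by
    rw [hy, ← Real.rpow_natCast, ← Real.rpow_mul (by norm_num), ← Real.rpow_natCast,
      ← Real.rpow_mul (by norm_num), mul_comm]
  refine ⟨y / (y - 1), by positivity, fun r hr => ?_⟩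
  obtain ⟨N, hN1, hN2⟩ := exists_nat_pow_near hr (one_lt_two : (1 : ℝ) < 2)
  rw [tsum_eq_sum (s := Finset.range (N + 1))]
  · calc _ ≤ ∑ k ∈ Finset.range (N + 1), ENNReal.ofReal (y ^ k) := by
          refine Finset.sum_le_sum fun k _ => ?_
          rw [hpow]
          split_ifs <;> simp
      _ = ENNReal.ofReal (∑ k ∈ Finset.range (N + 1), y ^ k) :=
          (ENNReal.ofReal_sum_of_nonneg fun k _ => by positivity).symm
      _ ≤ _ := by
          apply ENNReal.ofReal_le_ofReal
          rw [geom_sum_eq hy1.ne', div_mul_eq_mul_div]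
          gcongr
          have h1 : y ^ N ≤ r ^ η := by
            rw [← hpow]
            exact Real.rpow_le_rpow (by positivity) hN1 hη.le
          rw [pow_succ']
          nlinarith
  · intro k hk
    rw [if_neg]
    rw [not_le]
    refine hN2.trans_le (pow_le_pow_right₀ one_le_two ?_)
    simpa using hk

/-- Discs with centres outside `|w| < 2 ^ k`, whose radii have `η`-th powers with sum
`o(2 ^ (k η))`, form a small exceptional set. -/
theorem isSmallExceptional_of_shells {η : ℝ} (hη : 0 < η) {E : Set ℂ} (u : ℕ → Set ℂ)
    (r : ℕ → ℂ → ℝ≥0) (ε : ℕ → ℝ) (hε : Tendsto ε atTop (𝓝 0)) (hε0 : ∀ k, 0 ≤ ε k)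
    (hu : ∀ k, (u k).Countable) (hlow : ∀ k, ∀ w ∈ u k, (2 : ℝ) ^ k ≤ ‖w‖)
    (hsum : ∀ k, ∑' w : u k, (r k w : ℝ≥0∞) ^ η ≤ ENNReal.ofReal (ε k * ((2 : ℝ) ^ k) ^ η))
    (hE : E ⊆ ⋃ k, ⋃ w ∈ u k, ball w (r k w)) : IsSmallExceptional η E := by
  have (k : ℕ) : Countable (u k) := (hu k).to_subtype
  refine isSmallExceptional_of_countable (ι := Σ k, u k) hη (fun i => i.2)
    (fun i => r i.1 i.2) ?_ ?_
  · intro z hz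
    obtain ⟨k, hk⟩ := mem_iUnion.1 (hE hz)
    obtain ⟨w, hw, hzw⟩ := mem_iUnion₂.1 hk
    exact mem_iUnion.2 ⟨⟨k, w, hw⟩, hzw⟩
  obtain ⟨C, hC0, hC⟩ := tsum_ite_two_pow_le hη
  -- The shells beyond `K` contribute at most `δ C r ^ η`, the others a constant.
  have hbound : ∀ δ : ℝ, 0 < δ → ∃ A : ℝ, 0 ≤ A ∧ ∀ ρ : ℝ, 1 ≤ ρ →
      (∑' i : Σ k, u k, if ‖(i.2 : ℂ)‖ ≤ ρ then (r i.1 i.2 : ℝ≥0∞) ^ η else 0) ≤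
        ENNReal.ofReal (A + δ * C * ρ ^ η) := by
    intro δ hδ
    obtain ⟨K, hK⟩ := eventually_atTop.1 (hε.eventually_le_const hδ)
    refine ⟨∑ k ∈ Finset.range K, ε k * ((2 : ℝ) ^ k) ^ η,
      Finset.sum_nonneg fun k _ => mul_nonneg (hε0 k) (by positivity), fun ρ hρ => ?_⟩
    have hterm (k : ℕ) : (∑' w : u k, if ‖(w : ℂ)‖ ≤ ρ then (r k w : ℝ≥0∞) ^ η else 0) ≤
        (if k ∈ Finset.range K then ENNReal.ofReal (ε k * ((2 : ℝ) ^ k) ^ η) else 0) +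
          ENNReal.ofReal δ *
            (if (2 : ℝ) ^ k ≤ ρ then ENNReal.ofReal (((2 : ℝ) ^ k) ^ η) else 0) := by
      by_cases hkρ : (2 : ℝ) ^ k ≤ ρ
      · have h1 : (∑' w : u k, if ‖(w : ℂ)‖ ≤ ρ then (r k w : ℝ≥0∞) ^ η else 0) ≤
            ENNReal.ofReal (ε k * ((2 : ℝ) ^ k) ^ η) := by
          refine (ENNReal.tsum_le_tsum fun w => ?_).trans (hsum k)
          split_ifs <;> simp
        refine h1.trans ?_
        by_cases hkK : k ∈ Finset.range K
        · rw [if_pos hkK]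
          exact le_self_add
        · rw [if_neg hkK, zero_add, if_pos hkρ, ← ENNReal.ofReal_mul hδ.le]
          apply ENNReal.ofReal_le_ofReal
          have := hK k (by simpa using hkK)
          gcongr
      · rw [ENNReal.tsum_eq_zero.2 fun w => if_neg fun h => hkρ ((hlow k _ w.2).trans h)]
        exact zero_le
    rw [ENNReal.tsum_sigma']
    refine (ENNReal.tsum_le_tsum hterm).trans ?_
    rw [ENNReal.tsum_add, ENNReal.tsum_mul_left, ENNReal.ofReal_add (Finset.sum_nonneg fun k _ =>
      mul_nonneg (hε0 k) (by positivity)) (by positivity)]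
    refine add_le_add (le_of_eq ?_) ?_
    · rw [tsum_eq_sum (s := Finset.range K) fun k hk => if_neg hk, ENNReal.ofReal_sum_of_nonneg
        fun k _ => mul_nonneg (hε0 k) (by positivity)]
      exact Finset.sum_congr rfl fun k hk => if_pos hk
    · rw [mul_assoc, ENNReal.ofReal_mul hδ.le]
      gcongr
      exact hC ρ hρ
  rw [ENNReal.tendsto_nhds_zero]
  intro c hc
  obtain ⟨c', hc'0, hc'⟩ := ENNReal.lt_iff_exists_nnreal_btwn.1 hc
  have hc'0 : 0 < (c' : ℝ) := by exact_mod_cast hc'0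
  obtain ⟨A, hA0, hA⟩ := hbound (c' / (2 * C)) (by positivity)
  have hlim : Tendsto (fun ρ : ℝ => A / ρ ^ η) atTop (𝓝 0) :=
    tendsto_const_nhds.div_atTop (tendsto_rpow_atTop hη)
  filter_upwards [eventually_ge_atTop 1,
    hlim.eventually_le_const (show (0 : ℝ) < c' / 2 by positivity)] with ρ hρ hρA
  have hρ0 : 0 < ρ ^ η := by positivity
  refine le_trans ?_ hc'.le
  refine (ENNReal.div_le_div_right (hA ρ hρ) _).trans ?_
  rw [← ENNReal.ofReal_div_of_pos hρ0, ← ENNReal.ofReal_coe_nnreal]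
  apply ENNReal.ofReal_le_ofReal
  have : (A + c' / (2 * C) * C * ρ ^ η) / ρ ^ η = A / ρ ^ η + c' / 2 := by field_simp
  rw [this]
  linarith

/-- A set which contains the discs of a shell cover for all large shells, with parameters `ε` and
`η` tending to zero slowly, serves all exponents at once. -/
theorem exists_exceptional_set
    (hcov : ∀ ε η : ℝ, 0 < ε → 0 < η → ∀ᶠ k : ℕ in atTop, HasShellCover f ε η k) :
    ∃ E : Set ℂ, (∀ η : ℝ, 0 < η → IsSmallExceptional η E) ∧
      ∀ ε : ℝ, 0 < ε → ∃ R : ℝ, ∀ z : ℂ, R ≤ ‖z‖ → z ∉ E →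
        f z ≠ 0 ∧ |Real.log ‖f z‖ - ‖z‖| ≤ ε * ‖z‖ := by
  classical
  let P : ℕ → ℕ → Prop := fun k m => HasShellCover f (1 / (m + 1)) (1 / (m + 1)) k
  have hP (m : ℕ) : ∀ᶠ k : ℕ in atTop, P k m := hcov _ _ Nat.one_div_pos_of_nat
    Nat.one_div_pos_of_nat
  -- The best precision `1 / (m + 1)` with `m ≤ k` available in the `k`-th shell.
  set m : ℕ → ℕ := fun k => Nat.findGreatest (P k) k with hm
  have hm_ge (M : ℕ) : ∀ᶠ k : ℕ in atTop, M ≤ m k := by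
    filter_upwards [hP M, eventually_ge_atTop M] with k h1 h2
    exact Nat.le_findGreatest h2 h1
  have hmP : ∀ᶠ k : ℕ in atTop, P k (m k) := by
    filter_upwards [hP 0] with k h1
    exact Nat.findGreatest_spec (P := P k) (Nat.zero_le k) h1
  have hmlim : Tendsto (fun k => 1 / ((m k : ℝ) + 1)) atTop (𝓝 0) :=
    tendsto_one_div_add_atTop_nhds_zero_nat.comp (tendsto_atTop.2 hm_ge)
  obtain ⟨k₁, hk₁⟩ := eventually_atTop.1 hmP
  have hex (k : ℕ) : ∃ (u : Set ℂ) (r : ℂ → ℝ≥0), k₁ ≤ k → (u.Countable ∧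
    (∀ w ∈ u, (2 : ℝ) ^ k ≤ ‖w‖ ∧ ‖w‖ < 2 ^ (k + 1) ∧ (r w : ℝ) ≤ 2 ^ k) ∧
    ∑' w : u, (r w : ℝ≥0∞) ^ (1 / ((m k : ℝ) + 1)) ≤
      ENNReal.ofReal (1 / ((m k : ℝ) + 1) * ((2 : ℝ) ^ k) ^ (1 / ((m k : ℝ) + 1))) ∧
    ∀ z : ℂ, (2 : ℝ) ^ k ≤ ‖z‖ → ‖z‖ < 2 ^ (k + 1) → z ∉ ⋃ w ∈ u, ball w (r w) →
      f z ≠ 0 ∧ |Real.log ‖f z‖ - ‖z‖| ≤ 1 / ((m k : ℝ) + 1) * ‖z‖) := by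
    by_cases hk : k₁ ≤ k
    · obtain ⟨u, r, h⟩ := hk₁ k hk
      exact ⟨u, r, fun _ => h⟩
    · exact ⟨∅, 0, fun h => absurd h hk⟩
  choose u r hur using hex
  refine ⟨⋃ k ∈ Ici k₁, ⋃ w ∈ u k, ball w (r k w), fun η hη => ?_, fun ε hε => ?_⟩
  · obtain ⟨K₀, hK₀⟩ := eventually_atTop.1 (hmlim.eventually_le_const hη)
    set K := max (max K₀ k₁) 1 with hK
    -- The discs in the shells below `K` lie in the disc of radius `2 ^ (K + 1) + 1` about `1`.
    set D : ℝ≥0 := 2 ^ (K + 1) + 1 with hD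
    refine isSmallExceptional_of_shells hη
      (fun k => if k = 0 then {1} else if K ≤ k then u k else ∅)
      (fun k w => if k = 0 then D else r k w)
      (fun k => if k = 0 then (D : ℝ) ^ η else 1 / ((m k : ℝ) + 1)) ?_ ?_ ?_ ?_ ?_ ?_
    · refine hmlim.congr' ?_
      filter_upwards [eventually_gt_atTop 0] with k hk
      rw [if_neg hk.ne']
    · intro k
      split_ifs <;> positivity
    · intro k
      split_ifs with h1 h2
      · exact countable_singleton _
      · exact (hur k (by omega)).1
      · exact countable_empty
    · intro k w hw
      split_ifs at hw with h1 h2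
      · rw [mem_singleton_iff] at hw
        simp [h1, hw]
      · exact ((hur k (by omega)).2.1 w hw).1
      · exact absurd hw (notMem_empty _)
    · intro k
      by_cases h1 : k = 0
      · have hset : (if k = 0 then {1} else if K ≤ k then u k else ∅ : Set ℂ) = {1} := if_pos h1
        rw [tsum_congr_set_coe (fun w => ((if k = 0 then D else r k w : ℝ≥0) : ℝ≥0∞) ^ η) hset,
          tsum_singleton (1 : ℂ) fun w => ((if k = 0 then D else r k w : ℝ≥0) : ℝ≥0∞) ^ η]
        simp only [h1, if_true, pow_zero, Real.one_rpow, mul_one]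
        rw [← ENNReal.ofReal_rpow_of_nonneg (NNReal.coe_nonneg D) hη.le, ENNReal.ofReal_coe_nnreal]
      by_cases h2 : K ≤ k
      · have hset : (if k = 0 then {1} else if K ≤ k then u k else ∅ : Set ℂ) = u k := by
          rw [if_neg h1, if_pos h2]
        rw [tsum_congr_set_coe (fun w => ((if k = 0 then D else r k w : ℝ≥0) : ℝ≥0∞) ^ η) hset]
        simp only [if_neg h1]
        obtain ⟨-, hr, hs, -⟩ := hur k (by omega)
        set e := 1 / ((m k : ℝ) + 1) with he
        have he0 : 0 < e := by positivity
        have heη : e ≤ η := hK₀ k (by omega)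
        -- As the radii are at most `2 ^ k`, the bound for the exponent `e` implies that for `η`.
        calc ∑' w : u k, (r k w : ℝ≥0∞) ^ η
            ≤ ∑' w : u k, ENNReal.ofReal (((2 : ℝ) ^ k) ^ (η - e)) * (r k w : ℝ≥0∞) ^ e := by
              refine ENNReal.tsum_le_tsum fun w => ?_
              have h3 := (hr w w.2).2.2
              rw [← ENNReal.ofReal_coe_nnreal,
                ENNReal.ofReal_rpow_of_nonneg (NNReal.coe_nonneg _) hη.le,
                ENNReal.ofReal_rpow_of_nonneg (NNReal.coe_nonneg _) he0.le,
                ← ENNReal.ofReal_mul (by positivity)]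
              apply ENNReal.ofReal_le_ofReal
              calc ((r k w : ℝ≥0) : ℝ) ^ η = (r k w : ℝ) ^ (η - e) * (r k w : ℝ) ^ e := by
                    rw [← Real.rpow_add_of_nonneg (NNReal.coe_nonneg _) (by linarith) he0.le,
                      sub_add_cancel]
                _ ≤ _ := by
                    gcongr
          _ ≤ ENNReal.ofReal (((2 : ℝ) ^ k) ^ (η - e)) *
                ENNReal.ofReal (e * ((2 : ℝ) ^ k) ^ e) := by
              rw [ENNReal.tsum_mul_left]
              gcongr
          _ = _ := by
              rw [← ENNReal.ofReal_mul (by positivity)]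
              congr 1
              rw [mul_left_comm, ← Real.rpow_add (by positivity), sub_add_cancel]
      · have hset : (if k = 0 then {1} else if K ≤ k then u k else ∅ : Set ℂ) = ∅ := by
          rw [if_neg h1, if_neg h2]
        rw [tsum_congr_set_coe (fun w => ((if k = 0 then D else r k w : ℝ≥0) : ℝ≥0∞) ^ η) hset]
        simp
    · intro z hz
      obtain ⟨k, hk, hzk⟩ := mem_iUnion₂.1 hz
      obtain ⟨w, hw, hzw⟩ := mem_iUnion₂.1 hzk
      by_cases hkK : K ≤ k
      · refine mem_iUnion.2 ⟨k, ?_⟩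
        rw [if_neg (by omega), if_pos hkK]
        refine mem_iUnion₂.2 ⟨w, hw, ?_⟩
        rwa [if_neg (by omega)]
      · refine mem_iUnion.2 ⟨0, mem_iUnion₂.2 ⟨1, by simp, ?_⟩⟩
        obtain ⟨-, h2, h3⟩ := (hur k hk).2.1 w hw
        rw [if_pos rfl, mem_ball_iff_norm, hD]
        rw [mem_ball_iff_norm] at hzw
        push_cast
        have h4 : (2 : ℝ) ^ (k + 1) ≤ 2 ^ K := pow_le_pow_right₀ one_le_two (by omega)
        have h5 : (2 : ℝ) ^ k ≤ 2 ^ K := pow_le_pow_right₀ one_le_two (by omega)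
        have h6 : ‖z - 1‖ ≤ ‖z - w‖ + ‖w‖ + ‖(1 : ℂ)‖ := by
          calc ‖z - 1‖ = ‖(z - w) + w + (-1)‖ := by congr 1; ring
            _ ≤ _ := by simpa using norm_add₃_le (a := z - w) (b := w) (c := (-1 : ℂ))
        rw [norm_one] at h6
        rw [pow_succ (2 : ℝ) K]
        linarith
  · obtain ⟨K₀, hK₀⟩ := eventually_atTop.1 (hmlim.eventually_le_const hε)
    set K := max K₀ k₁ with hK
    refine ⟨2 ^ K, fun z hz hzE => ?_⟩
    obtain ⟨k, hk1, hk2⟩ := exists_nat_pow_near ((one_le_pow₀ one_le_two).trans hz)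
      (one_lt_two : (1 : ℝ) < 2)
    have hKk : K ≤ k := by
      have := (pow_lt_pow_iff_right₀ (one_lt_two : (1 : ℝ) < 2)).1 (hz.trans_lt hk2)
      omega
    obtain ⟨h1, h2⟩ := (hur k (by omega)).2.2.2 z hk1 hk2 fun hmem =>
      hzE (mem_iUnion₂.2 ⟨k, by rw [mem_Ici]; omega, hmem⟩)
    refine ⟨h1, h2.trans ?_⟩
    gcongr
    exact hK₀ k (by omega)

/-- A shell cover with exponent `1` and small `ε` cannot cover the part of a ray in the shell. -/
theorem exists_ray_of_hasShellCover {ε : ℝ} (hε : ε < 1 / 4) {k : ℕ}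
    (h : HasShellCover f ε 1 k) (θ : ℝ) : ∃ ρ : ℝ, 2 ^ k ≤ ρ ∧
      f (ρ * Complex.exp (θ * Complex.I)) ≠ 0 ∧
      (1 - ε) * ρ ≤ Real.log ‖f (ρ * Complex.exp (θ * Complex.I))‖ := by
  obtain ⟨u, r, hu, -, hsum, hgood⟩ := h
  set X : ℝ := 2 ^ k with hX
  have hX0 : 0 < X := by positivity
  -- The radii whose points on the ray are covered: each disc meets the ray in a short segment.
  set A : Set ℝ := ⋃ w ∈ u, {ρ : ℝ | (ρ : ℂ) * Complex.exp (θ * Complex.I) ∈ ball w (r w)} with hA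
  have hvol (w : ℂ) : volume {ρ : ℝ | (ρ : ℂ) * Complex.exp (θ * Complex.I) ∈ ball w (r w)} ≤
      4 * (r w : ℝ≥0∞) := by
    rcases eq_empty_or_nonempty {ρ : ℝ | (ρ : ℂ) * Complex.exp (θ * Complex.I) ∈ ball w (r w)}
      with he | ⟨ρ₀, hρ₀⟩
    · rw [he, measure_empty]; exact zero_le
    · have hsub : {ρ : ℝ | (ρ : ℂ) * Complex.exp (θ * Complex.I) ∈ ball w (r w)} ⊆
          ball ρ₀ (2 * r w) := by
        intro ρ hρ
        have h1 : ‖(ρ : ℂ) * Complex.exp (θ * Complex.I) - w‖ < r w := mem_ball_iff_norm.1 hρ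
        have h2 : ‖(ρ₀ : ℂ) * Complex.exp (θ * Complex.I) - w‖ < r w := mem_ball_iff_norm.1 hρ₀
        rw [mem_ball, Real.dist_eq]
        have h3 : |ρ - ρ₀| = ‖((ρ : ℂ) * Complex.exp (θ * Complex.I) - w) -
            ((ρ₀ : ℂ) * Complex.exp (θ * Complex.I) - w)‖ := by
          rw [sub_sub_sub_cancel_right, ← sub_mul, norm_mul, Complex.norm_exp_ofReal_mul_I, mul_one,
            ← Complex.ofReal_sub, Complex.norm_real, Real.norm_eq_abs]
        rw [h3]
        linarith [norm_sub_le ((ρ : ℂ) * Complex.exp (θ * Complex.I) - w)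
          ((ρ₀ : ℂ) * Complex.exp (θ * Complex.I) - w)]
      refine (measure_mono hsub).trans ?_
      rw [Real.volume_ball, ← mul_assoc, ENNReal.ofReal_mul (by norm_num),
        ENNReal.ofReal_coe_nnreal]
      norm_num
  have hAvol : volume A < volume (Ico X (2 * X)) := by
    calc volume A ≤ ∑' w : u,
          volume {ρ : ℝ | (ρ : ℂ) * Complex.exp (θ * Complex.I) ∈ ball (w : ℂ) (r w)} :=
          measure_biUnion_le _ hu _
      _ ≤ ∑' w : u, 4 * (r w : ℝ≥0∞) ^ (1 : ℝ) := by
          refine ENNReal.tsum_le_tsum fun w => ?_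
          rw [ENNReal.rpow_one]
          exact hvol w
      _ ≤ 4 * ENNReal.ofReal (ε * X) := by
          rw [ENNReal.tsum_mul_left]
          rw [Real.rpow_one] at hsum
          gcongr
      _ = ENNReal.ofReal (4 * (ε * X)) := by
          rw [ENNReal.ofReal_mul (by norm_num : (0 : ℝ) ≤ 4), ENNReal.ofReal_ofNat]
      _ < _ := by
          rw [Real.volume_Ico]
          exact (ENNReal.ofReal_lt_ofReal_iff (by linarith)).2 (by nlinarith)
  obtain ⟨ρ, hρ1, hρ2⟩ : ∃ ρ, ρ ∈ Ico X (2 * X) ∧ ρ ∉ A := by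
    by_contra! hcon
    exact absurd (measure_mono (show Ico X (2 * X) ⊆ A from hcon)) (not_le.2 hAvol)
  have hρ0 : 0 ≤ ρ := hX0.le.trans hρ1.1
  have hnorm : ‖(ρ : ℂ) * Complex.exp (θ * Complex.I)‖ = ρ := by
    rw [norm_mul, Complex.norm_exp_ofReal_mul_I, mul_one, Complex.norm_real, Real.norm_eq_abs,
      abs_of_nonneg hρ0]
  obtain ⟨h1, h2⟩ := hgood (ρ * Complex.exp (θ * Complex.I)) (by rw [hnorm]; exact hρ1.1)
    (by rw [hnorm, pow_succ']; exact hρ1.2) (by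
      intro hmem
      obtain ⟨w, hw, hmem⟩ := mem_iUnion₂.1 hmem
      exact hρ2 (mem_iUnion₂.2 ⟨w, hw, hmem⟩))
  refine ⟨ρ, hρ1.1, h1, ?_⟩
  rw [hnorm] at h2
  linarith [(abs_le.1 h2).1]

/-- The upper bound is immediate; for the lower one, every shell contains a point of the ray outside
the discs of a cover with exponent `1`. -/
theorem plIndicator_eq_one (hle : ∀ z, ‖f z‖ ≤ Real.exp ‖z‖)
    (hcov : ∀ ε η : ℝ, 0 < ε → 0 < η → ∀ᶠ k : ℕ in atTop, HasShellCover f ε η k) (θ : ℝ) :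
    plIndicator 1 f θ = 1 := by
  have hval (r : ℝ) (hr : f (r * Complex.exp (θ * Complex.I)) ≠ 0) :
      ((r ^ (-1 : ℝ) : ℝ) : EReal) * ENNReal.log ‖f (r * Complex.exp (θ * Complex.I))‖ₑ =
        ((r⁻¹ * Real.log ‖f (r * Complex.exp (θ * Complex.I))‖ : ℝ) : EReal) := by
    rw [← ofReal_norm, ENNReal.log_ofReal_of_pos (norm_pos_iff.2 hr), Real.rpow_neg_one,
      EReal.coe_mul]
  apply le_antisymm
  · refine limsup_le_of_le (by isBoundedDefault) ?_
    filter_upwards [eventually_gt_atTop 0] with r hr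
    by_cases hf : f (r * Complex.exp (θ * Complex.I)) = 0
    · rw [hf, enorm_zero, ENNReal.log_zero, EReal.coe_mul_bot_of_pos (by positivity)]
      exact bot_le
    · rw [hval r hf, ← EReal.coe_one, EReal.coe_le_coe_iff, inv_mul_le_iff₀ hr, mul_one]
      refine (log_norm_le_norm hle _).trans (le_of_eq ?_)
      rw [norm_mul, Complex.norm_exp_ofReal_mul_I, mul_one, Complex.norm_real, Real.norm_eq_abs,
        abs_of_pos hr]
  · refine EReal.ge_of_forall_gt_iff_ge.1 fun c hc => ?_
    have hc1 : c < 1 := by exact_mod_cast hc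
    set ε := min (1 - c) (1 / 8) with hε
    have hε0 : 0 < ε := lt_min (by linarith) (by norm_num)
    have hε1 : ε ≤ 1 - c := min_le_left _ _
    have hε2 : ε < 1 / 4 := (min_le_right _ _).trans_lt (by norm_num)
    refine le_limsup_of_frequently_le ?_ (by isBoundedDefault)
    rw [frequently_atTop]
    intro R
    obtain ⟨k, hk, hkR⟩ := ((hcov ε 1 hε0 one_pos).and
      ((tendsto_pow_atTop_atTop_of_one_lt (one_lt_two : (1 : ℝ) < 2)).eventually_ge_atTop
        R)).exists
    obtain ⟨ρ, h1, h2, h3⟩ := exists_ray_of_hasShellCover hε2 hk θ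
    have hρ0 : 0 < ρ := lt_of_lt_of_le (by positivity) h1
    refine ⟨ρ, hkR.trans h1, ?_⟩
    rw [hval ρ h2, EReal.coe_le_coe_iff, le_inv_mul_iff₀ hρ0]
    refine le_trans ?_ h3
    nlinarith

end Exceptional

/-! ### Circle averages of test functions and the logarithmic kernel -/

section LogKernel

open Metric EntireGrowth

theorem exists_support_radius {χ : ℂ → ℝ} (hχc : HasCompactSupport χ) :
    ∃ S : ℝ, 0 < S ∧ ∀ z, S ≤ ‖z‖ → χ z = 0 := by
  obtain ⟨S, hS⟩ := hχc.isBounded.subset_ball 0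
  refine ⟨max S 1, by positivity, fun z hz => ?_⟩
  by_contra hne
  have := hS (subset_tsupport _ hne)
  rw [mem_ball_zero_iff] at this
  linarith [le_max_left S 1]

theorem norm_circleMap_ge (z : ℂ) (s θ : ℝ) : ‖z‖ - |s| ≤ ‖circleMap z s θ‖ := by
  have h1 : ‖circleMap z s θ - z‖ = |s| := by rw [circleMap_sub_center, norm_circleMap_zero]
  have h2 := norm_sub_norm_le z (circleMap z s θ)
  rw [norm_sub_rev, h1] at h2
  linarith

theorem circleAverage_eq_zero_of_norm_ge {χ : ℂ → ℝ} {S s : ℝ} (hS : ∀ z, S ≤ ‖z‖ → χ z = 0)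
    {z : ℂ} (hz : S + |s| ≤ ‖z‖) : Real.circleAverage χ z s = 0 := by
  rw [Real.circleAverage_def]
  have : ∀ θ, χ (circleMap z s θ) = 0 := fun θ => hS _ (by linarith [norm_circleMap_ge z s θ])
  simp [this]

theorem continuous_circleAverage_center {χ : ℂ → ℝ} (hχ : Continuous χ) (s : ℝ) :
    Continuous fun z => Real.circleAverage χ z s := by
  have hc : Continuous (Function.uncurry fun (z : ℂ) (θ : ℝ) => χ (circleMap z s θ)) := by
    refine hχ.comp ?_
    unfold circleMap
    fun_prop
  have h := intervalIntegral.continuous_parametric_intervalIntegral_of_continuous'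
    (μ := volume) hc 0 (2 * π)
  simp only [Real.circleAverage_def, smul_eq_mul]
  exact continuous_const.mul h

theorem hasCompactSupport_circleAverage {χ : ℂ → ℝ} (hχc : HasCompactSupport χ) (s : ℝ) :
    HasCompactSupport fun z => Real.circleAverage χ z s := by
  obtain ⟨S, -, hS⟩ := exists_support_radius hχc
  refine HasCompactSupport.intro (isCompact_closedBall (0 : ℂ) (S + |s|)) fun z hz => ?_
  rw [mem_closedBall_zero_iff, not_le] at hz
  exact circleAverage_eq_zero_of_norm_ge hS hz.le

/-- The integrand for Fubini's theorem on circles around the points of the plane. -/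
theorem integrable_mul_comp_circleMap {v χ : ℂ → ℝ} (hv : LocallyIntegrable v)
    (hχ : Continuous χ) (hχc : HasCompactSupport χ) (s : ℝ) :
    Integrable (fun p : ℝ × ℂ => v p.2 * χ (circleMap p.2 s p.1))
      ((volume.restrict (Ioc 0 (2 * π))).prod volume) := by
  obtain ⟨S, -, hS⟩ := exists_support_radius hχc
  obtain ⟨C, hC⟩ := hχc.exists_bound_of_continuous hχ
  have hc : Continuous fun p : ℝ × ℂ => χ (circleMap p.2 s p.1) := by
    refine hχ.comp ?_
    unfold circleMap
    fun_prop
  have h1 : Integrable ((closedBall (0 : ℂ) (S + |s|)).indicator v) :=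
    (integrable_indicator_iff measurableSet_closedBall).2
      (hv.integrableOn_isCompact (isCompact_closedBall _ _))
  have h2 := (h1.comp_snd (volume.restrict (Ioc 0 (2 * π)))).bdd_mul (c := C)
    hc.aestronglyMeasurable (Eventually.of_forall fun p => hC _)
  refine h2.congr (Eventually.of_forall fun p => ?_)
  by_cases hp : p.2 ∈ closedBall (0 : ℂ) (S + |s|)
  · simp only [indicator_of_mem hp, mul_comm]
  · rw [mem_closedBall_zero_iff, not_le] at hp
    have : χ (circleMap p.2 s p.1) = 0 := hS _ (by linarith [norm_circleMap_ge p.2 s p.1])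
    simp only [this, mul_zero, zero_mul]

/-- Averaging over circles is a symmetric operation. -/
theorem integral_mul_circleAverage_comm {v χ : ℂ → ℝ} (hvm : Measurable v)
    (hv : LocallyIntegrable v) (hχ : Continuous χ) (hχc : HasCompactSupport χ) (s : ℝ) :
    Integrable (fun z => χ z * Real.circleAverage v z s) ∧
      ∫ z, v z * Real.circleAverage χ z s = ∫ z, χ z * Real.circleAverage v z s := by
  set ν : Measure ℝ := volume.restrict (Ioc 0 (2 * π)) with hν
  set F : ℝ × ℂ → ℝ := fun p => v p.2 * χ (circleMap p.2 s p.1) with hF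
  set G : ℝ × ℂ → ℝ := fun p => χ p.2 * v (circleMap p.2 (-s) p.1) with hG
  have hcm (s : ℝ) : Continuous fun p : ℝ × ℂ => circleMap p.2 s p.1 := by
    unfold circleMap
    fun_prop
  have hFint : Integrable F (ν.prod volume) := integrable_mul_comp_circleMap hv hχ hχc s
  -- For a fixed angle, the two integrands are translates of each other.
  have htrans (h : ℝ → ℝ) (θ : ℝ) : ∫ z, h (G (θ, z)) = ∫ z, h (F (θ, z)) := by
    rw [← integral_add_right_eq_self (fun z => h (G (θ, z))) (circleMap 0 s θ)]
    refine integral_congr_ae (Eventually.of_forall fun z => ?_)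
    simp only [hF, hG]
    have e1 : circleMap (z + circleMap 0 s θ) (-s) θ = z := by
      simp [circleMap]
    have e2 : z + circleMap 0 s θ = circleMap z s θ := by simp [circleMap]
    rw [e1, e2, mul_comm]
  have hGint : Integrable G (ν.prod volume) := by
    have hGm : Measurable G :=
      (hχ.measurable.comp measurable_snd).mul (hvm.comp (hcm (-s)).measurable)
    rw [integrable_prod_iff hGm.aestronglyMeasurable]
    constructor
    · refine Eventually.of_forall fun θ => ?_
      have h1 : LocallyIntegrable fun z => v (z + circleMap 0 (-s) θ) := by
        intro z
        obtain ⟨U, hU, hint⟩ := hv (z + circleMap 0 (-s) θ)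
        refine ⟨(fun z => z + circleMap 0 (-s) θ) ⁻¹' U,
          (continuous_add_const _).continuousAt.preimage_mem_nhds hU, ?_⟩
        exact (measurePreserving_add_right volume (circleMap 0 (-s) θ)).integrableOn_comp_preimage
          (MeasurableEquiv.addRight _).measurableEmbedding |>.2 hint
      refine (h1.integrable_smul_left_of_hasCompactSupport hχ hχc).congr
        (Eventually.of_forall fun z => ?_)
      simp [hG, circleMap]
    · refine hFint.integral_norm_prod_left.congr (Eventually.of_forall fun θ => ?_)
      exact (htrans (fun x => ‖x‖) θ).symm
  have hA (v : ℂ → ℝ) (s : ℝ) (z : ℂ) :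
      Real.circleAverage v z s = (2 * π)⁻¹ * ∫ θ, v (circleMap z s θ) ∂ν := by
    rw [Real.circleAverage_def, smul_eq_mul, intervalIntegral.integral_of_le (by positivity)]
  have e1 (z : ℂ) : v z * Real.circleAverage χ z s = (2 * π)⁻¹ * ∫ θ, F (θ, z) ∂ν := by
    rw [hA, mul_left_comm, ← integral_const_mul]
  have e2 (z : ℂ) : χ z * Real.circleAverage v z s = (2 * π)⁻¹ * ∫ θ, G (θ, z) ∂ν := by
    rw [← Real.circleAverage_neg_radius, hA, mul_left_comm, ← integral_const_mul]
  refine ⟨?_, ?_⟩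
  · simp only [e2]
    exact hGint.integral_prod_right.const_mul _
  · simp only [e1, e2]
    rw [integral_const_mul, integral_const_mul]
    congr 1
    rw [← integral_integral_swap (f := fun θ z => F (θ, z)) hFint,
      ← integral_integral_swap (f := fun θ z => G (θ, z)) hGint]
    exact integral_congr_ae (Eventually.of_forall fun θ => (htrans id θ).symm)

theorem integral_mul_circleAverage_sub {v χ : ℂ → ℝ} (hvm : Measurable v)
    (hv : LocallyIntegrable v) (hχ : Continuous χ) (hχc : HasCompactSupport χ) (s : ℝ) :
    ∫ z, v z * (Real.circleAverage χ z s - χ z) =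
      ∫ z, χ z * (Real.circleAverage v z s - v z) := by
  obtain ⟨h1, h2⟩ := integral_mul_circleAverage_comm hvm hv hχ hχc s
  have h3 : Integrable fun z => v z * χ z := hv.integrable_smul_right_of_hasCompactSupport hχ hχc
  have h4 : Integrable fun z => v z * Real.circleAverage χ z s :=
    hv.integrable_smul_right_of_hasCompactSupport (continuous_circleAverage_center hχ s)
      (hasCompactSupport_circleAverage hχc s)
  simp only [mul_sub]
  rw [integral_sub h4 h3, h2, integral_sub h1 (by simpa only [mul_comm] using h3)]
  simp only [mul_comm]

theorem integral_circleAverage_sub_self {χ : ℂ → ℝ} (hχ : Continuous χ)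
    (hχc : HasCompactSupport χ) (s : ℝ) : ∫ z, (Real.circleAverage χ z s - χ z) = 0 := by
  have h := integral_mul_circleAverage_sub (v := fun _ => (1 : ℝ)) measurable_const
    continuous_const.locallyIntegrable hχ hχc s
  simpa [Real.circleAverage_const] using h

/-- The convolution of `χ` with the kernel `log⁺ (s / |w|)`. -/
noncomputable def logKernelConv (s : ℝ) (χ : ℂ → ℝ) (a : ℂ) : ℝ :=
  ∫ z, χ z * Real.posLog (s / ‖z - a‖)

theorem measurable_posLog : Measurable Real.posLog :=
  Real.continuous_posLog.measurable

theorem integrable_posLog_div (s : ℝ) : Integrable fun w : ℂ => Real.posLog (s / ‖w‖) := by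
  have h1 : LocallyIntegrable fun w : ℂ => Real.log ‖w‖ :=
    locallyIntegrable_log_norm (g := fun w => w) differentiable_id (z₀ := 1) one_ne_zero
  have h2 : IntegrableOn (fun w : ℂ => |Real.log s| + |Real.log ‖w‖|) (closedBall 0 |s|) :=
    (integrableOn_const measure_closedBall_lt_top.ne).add
      (h1.integrableOn_isCompact (isCompact_closedBall _ _)).abs
  rw [← integrable_indicator_iff measurableSet_closedBall] at h2
  refine h2.mono' (measurable_posLog.comp (by fun_prop)).aestronglyMeasurable
    (Eventually.of_forall fun w => ?_)
  rw [Real.norm_eq_abs, abs_of_nonneg Real.posLog_nonneg]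
  by_cases hw : w ∈ closedBall (0 : ℂ) |s|
  · rw [indicator_of_mem hw, Real.posLog_apply]
    refine max_le (by positivity) ?_
    rcases eq_or_ne s 0 with hs | hs
    · simp [hs]
    rcases eq_or_ne w 0 with hw0 | hw0
    · simp [hw0]
    rw [Real.log_div hs (norm_ne_zero_iff.2 hw0)]
    linarith [le_abs_self (Real.log s), neg_abs_le (Real.log ‖w‖)]
  · rw [indicator_of_notMem hw, (Real.posLog_eq_zero_iff _).2]
    rw [mem_closedBall_zero_iff, not_le] at hw
    rw [abs_div, abs_norm, div_le_one ((abs_nonneg s).trans_lt hw)]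
    exact hw.le

/-- The total mass of the kernel is the factor between a function and its convolution for small
`s`. -/
theorem integral_posLog_div_pos {s : ℝ} (hs : 0 < s) :
    0 < ∫ w : ℂ, Real.posLog (s / ‖w‖) := by
  rw [integral_pos_iff_support_of_nonneg (fun _ => Real.posLog_nonneg) (integrable_posLog_div s)]
  have hsub : ball ((s / 2 : ℝ) : ℂ) (s / 2) ⊆
      Function.support fun w : ℂ => Real.posLog (s / ‖w‖) := by
    intro w hw
    rw [mem_ball_iff_norm] at hw
    have h1 : ‖w‖ < s := by
      have := norm_sub_norm_le w ((s / 2 : ℝ) : ℂ)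
      rw [Complex.norm_real, Real.norm_eq_abs, abs_of_pos (by positivity)] at this
      linarith
    have h2 : w ≠ 0 := by
      rintro rfl
      rw [zero_sub, norm_neg, Complex.norm_real, Real.norm_eq_abs, abs_of_pos (by positivity)] at hw
      exact lt_irrefl _ hw
    have h3 : 1 < s / ‖w‖ := (one_lt_div (norm_pos_iff.2 h2)).2 h1
    rw [Function.mem_support, ne_eq, Real.posLog_eq_zero_iff, abs_of_pos (by linarith), not_le]
    exact h3
  exact (measure_ball_pos volume _ (by positivity)).trans_le (measure_mono hsub)

theorem logKernelConv_eq_add (s : ℝ) (χ : ℂ → ℝ) (a : ℂ) :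
    logKernelConv s χ a = ∫ w, χ (a + w) * Real.posLog (s / ‖w‖) := by
  rw [logKernelConv, ← integral_add_left_eq_self _ a]
  simp only [add_sub_cancel_left]

theorem continuous_logKernelConv {χ : ℂ → ℝ} (hχ : Continuous χ) (hχc : HasCompactSupport χ)
    (s : ℝ) : Continuous (logKernelConv s χ) := by
  obtain ⟨C, hC⟩ := hχc.exists_bound_of_continuous hχ
  have e : logKernelConv s χ = fun a => ∫ w, χ (a + w) * Real.posLog (s / ‖w‖) :=
    funext (logKernelConv_eq_add s χ)
  rw [e]
  refine continuous_of_dominated (bound := fun w => C * Real.posLog (s / ‖w‖)) (fun a => ?_)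
    (fun a => Eventually.of_forall fun w => ?_) ((integrable_posLog_div s).const_mul C)
    (Eventually.of_forall fun w => by fun_prop)
  · exact ((hχ.comp (continuous_const_add a)).measurable.mul
      (measurable_posLog.comp (by fun_prop))).aestronglyMeasurable
  · rw [norm_mul, Real.norm_eq_abs (Real.posLog _), abs_of_nonneg Real.posLog_nonneg]
    exact mul_le_mul_of_nonneg_right (hC _) Real.posLog_nonneg

theorem posLog_div_eq_zero {s : ℝ} (hs : 0 ≤ s) {w : ℂ} (hw : s ≤ ‖w‖) :
    Real.posLog (s / ‖w‖) = 0 := by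
  rw [Real.posLog_eq_zero_iff, abs_of_nonneg (by positivity)]
  exact div_le_one_of_le₀ hw (norm_nonneg _)

theorem logKernelConv_eq_zero {χ : ℂ → ℝ} {S s : ℝ} (hs : 0 ≤ s) (hS : ∀ z, S ≤ ‖z‖ → χ z = 0)
    {a : ℂ} (ha : S + s ≤ ‖a‖) : logKernelConv s χ a = 0 := by
  rw [logKernelConv]
  refine integral_eq_zero_of_ae (Eventually.of_forall fun z => ?_)
  rcases le_or_gt S ‖z‖ with h | h
  · simp [hS z h]
  · have h1 : s ≤ ‖z - a‖ := by
      have := norm_sub_norm_le a z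
      rw [norm_sub_rev] at this
      linarith
    simp [posLog_div_eq_zero hs h1]

/-- For small `s` the convolution with the kernel is close to a multiple of the function itself. -/
theorem abs_logKernelConv_sub_le {χ : ℂ → ℝ} (hχ : Continuous χ) (hχc : HasCompactSupport χ)
    {s ω : ℝ} (hs : 0 ≤ s) (a : ℂ) (hω : ∀ w, ‖w‖ ≤ s → |χ (a + w) - χ a| ≤ ω) :
    |logKernelConv s χ a - (∫ w : ℂ, Real.posLog (s / ‖w‖)) * χ a| ≤
      (∫ w : ℂ, Real.posLog (s / ‖w‖)) * ω := by
  obtain ⟨C, hC⟩ := hχc.exists_bound_of_continuous hχ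
  have hint := integrable_posLog_div s
  have h1 : Integrable fun w => χ (a + w) * Real.posLog (s / ‖w‖) :=
    hint.bdd_mul (c := C) (hχ.comp (continuous_const_add a)).aestronglyMeasurable
      (Eventually.of_forall fun w => hC _)
  rw [logKernelConv_eq_add, ← integral_mul_const, ← integral_mul_const,
    ← integral_sub h1 (hint.mul_const _), ← Real.norm_eq_abs]
  refine norm_integral_le_of_norm_le (hint.mul_const ω) (Eventually.of_forall fun w => ?_)
  have e : χ (a + w) * Real.posLog (s / ‖w‖) - Real.posLog (s / ‖w‖) * χ a =
      Real.posLog (s / ‖w‖) * (χ (a + w) - χ a) := by ring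
  rw [e, norm_mul, Real.norm_eq_abs, Real.norm_eq_abs, abs_of_nonneg Real.posLog_nonneg]
  rcases le_or_gt ‖w‖ s with h | h
  · exact mul_le_mul_of_nonneg_left (hω w h) Real.posLog_nonneg
  · rw [posLog_div_eq_zero hs h.le, zero_mul, zero_mul]

/-- The kernel identity for a single logarithm, by the formula for its circle averages. -/
theorem integral_log_norm_sub_mul {χ : ℂ → ℝ} (hχ : Continuous χ) (hχc : HasCompactSupport χ)
    {s : ℝ} (hs : 0 < s) (a : ℂ) :
    ∫ z, Real.log ‖z - a‖ * (Real.circleAverage χ z s - χ z) = logKernelConv s χ a := by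
  have hd : Differentiable ℂ fun z : ℂ => z - a := by fun_prop
  rw [integral_mul_circleAverage_sub (measurable_log_norm_entire hd)
    (locallyIntegrable_log_norm hd (z₀ := a + 1) (by simp)) hχ hχc, logKernelConv]
  refine integral_congr_ae ?_
  filter_upwards [compl_mem_ae_iff.2 (measure_singleton a)] with z hz
  have hza : ‖z - a‖ ≠ 0 := norm_ne_zero_iff.2 (sub_ne_zero.2 hz)
  rw [circleAverage_log_norm_sub_const_eq_log_radius_add_posLog hs.ne']
  congr 1
  have h1 := Real.posLog_sub_posLog_inv (x := s⁻¹ * ‖z - a‖)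
  rw [Real.log_mul (inv_ne_zero hs.ne') hza, Real.log_inv, mul_inv, inv_inv, ← div_eq_mul_inv] at h1
  linarith

end LogKernel

/-! ### Zeros and the logarithmic kernel -/

section KernelZeros

open Metric EntireGrowth

variable {g : ℂ → ℂ}

/-- Jensen's formula integrated against a test function. -/
theorem integral_log_norm_mul_circleAverage_sub (hg : Differentiable ℂ g) {z₀ : ℂ} (h₀ : g z₀ ≠ 0)
    {χ : ℂ → ℝ} (hχ : Continuous χ) (hχc : HasCompactSupport χ) {s : ℝ} (hs : 0 < s) :
    ∫ z, Real.log ‖g z‖ * (Real.circleAverage χ z s - χ z) =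
      ∫ a, logKernelConv s χ a ∂(zeroMeasure g) := by
  obtain ⟨S, -, hS⟩ := exists_support_radius hχc
  obtain ⟨C, hC⟩ := hχc.exists_bound_of_continuous hχ
  have hfin := finite_zeros_closedBall hg h₀ 0 (S + s)
  set F := hfin.toFinset with hF
  have hrestr := zeroMeasure_restrict_closedBall hg h₀ (c := 0) (R := S + s) (F := F) (by simp [hF])
  have hR : ∫ a, logKernelConv s χ a ∂(zeroMeasure g) =
      ∑ a ∈ F, (analyticOrderNatAt g a : ℝ) * logKernelConv s χ a := by
    rw [← setIntegral_eq_integral_of_forall_compl_eq_zero (s := closedBall 0 (S + s)), hrestr,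
      integral_finsetSum_measure]
    · refine Finset.sum_congr rfl fun a _ => ?_
      rw [integral_smul_measure, integral_dirac]
      simp
    · intro a _
      exact (integrable_dirac (by simp [enorm_lt_top])).smul_measure (by simp)
    · intro a ha
      rw [mem_closedBall_zero_iff, not_le] at ha
      exact logKernelConv_eq_zero hs.le hS ha.le
  have hzero : ∀ᵐ z : ℂ, g z ≠ 0 := by
    have h1 : {z | g z = 0} ⊆ ⋃ n : ℕ, {z ∈ closedBall (0 : ℂ) n | g z = 0} := fun z hz => by
      obtain ⟨n, hn⟩ := exists_nat_ge ‖z‖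
      exact mem_iUnion.2 ⟨n, by rwa [mem_closedBall_zero_iff], hz⟩
    have h2 : {z | g z = 0}.Countable := (countable_iUnion fun n : ℕ =>
      (finite_zeros_closedBall hg h₀ 0 n).countable).mono h1
    exact h2.ae_notMem volume
  have hint (a : ℂ) : Integrable fun z => χ z * Real.posLog (s / ‖z - a‖) :=
    ((integrable_posLog_div s).comp_sub_right a).bdd_mul (c := C) hχ.aestronglyMeasurable
      (Eventually.of_forall hC)
  rw [integral_mul_circleAverage_sub (measurable_log_norm_entire hg)
    (locallyIntegrable_log_norm hg h₀) hχ hχc, hR]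
  simp only [logKernelConv, ← integral_const_mul]
  rw [← integral_finsetSum _ fun a _ => (hint a).const_mul _]
  refine integral_congr_ae ?_
  filter_upwards [hzero] with z hz
  rcases le_or_gt S ‖z‖ with h | h
  · simp [hS z h]
  · rw [jensen_sum hg hz hs (F := F), add_sub_cancel_left, Finset.mul_sum]
    · exact Finset.sum_congr rfl fun a _ => by ring
    · intro a ha hga
      rw [hF, Finite.mem_toFinset]
      refine ⟨?_, hga⟩
      rw [mem_closedBall_iff_norm] at ha
      rw [mem_closedBall_zero_iff]
      have := norm_le_norm_add_norm_sub' a z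
      linarith

/-- Rescaling the zero counting measure of `f` amounts to rescaling the variable of `f`. -/
theorem rescaleMeasure_zeroMeasure {f : ℂ → ℂ} {t : ℝ} (ht : 0 < t) :
    rescaleMeasure 1 t (zeroMeasure f) =
      ENNReal.ofReal t⁻¹ • zeroMeasure fun z => f (t * z) := by
  have ht0 : (t : ℂ) ≠ 0 := Complex.ofReal_ne_zero.2 ht.ne'
  have ho (z : ℂ) : analyticOrderAt (fun w => f (t * w)) z = analyticOrderAt f (t * z) := by
    have h := analyticOrderAt_comp_of_deriv_ne_zero (f := f) (g := fun w : ℂ => (t : ℂ) * w)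
      (z₀ := z) (by fun_prop) (by simpa [deriv_const_mul_field] using ht0)
    exact h
  rw [rescaleMeasure, Real.rpow_neg_one]
  congr 1
  ext B hB
  have hm : Measurable fun z : ℂ => z / t := by fun_prop
  rw [Measure.map_apply hm hB, zeroMeasure, zeroMeasure, Measure.sum_apply _ (hm hB),
    Measure.sum_apply _ hB, ← (Equiv.mulLeft₀ (t : ℂ) ht0).tsum_eq]
  refine tsum_congr fun z => ?_
  rw [Equiv.mulLeft₀_apply, ho, Measure.smul_apply, Measure.smul_apply,
    Measure.dirac_apply' _ (hm hB), Measure.dirac_apply' _ hB]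
  congr 1
  have e : (t : ℂ) * z ∈ (fun z : ℂ => z / t) ⁻¹' B ↔ z ∈ B := by
    rw [mem_preimage, mul_div_cancel_left₀ z ht0]
  by_cases h : z ∈ B
  · rw [indicator_of_mem h, indicator_of_mem (e.2 h)]
    rfl
  · rw [indicator_of_notMem h, indicator_of_notMem fun h' => h (e.1 h')]

end KernelZeros
/-! ### The polar measure -/

section Polar

open Metric EntireGrowth

instance : IsProbabilityMeasure uniformAngle := by
  refine ⟨?_⟩
  rw [uniformAngle, Measure.smul_apply, Measure.restrict_apply_univ, Real.volume_Ioc, smul_eq_mul,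
    ← ENNReal.ofReal_mul (by positivity), ENNReal.ofReal_eq_one]
  field_simp
  ring

theorem integral_uniformAngle_circleMap (K : ℂ → ℝ) (r : ℝ) :
    ∫ θ, K (circleMap 0 r θ) ∂uniformAngle = Real.circleAverage K 0 r := by
  rw [uniformAngle, integral_smul_measure, ENNReal.toReal_ofReal (by positivity),
    Real.circleAverage_def, one_div, ← intervalIntegral.integral_of_le (by linarith [Real.pi_pos])]
  congr 1
  have h := ((periodic_circleMap 0 r).comp K).intervalIntegral_add_eq (-π) 0
  rw [show -π + 2 * π = π by ring, zero_add] at h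
  exact h

theorem measurable_polar :
    Measurable fun p : ℝ × ℝ => (p.1 : ℂ) * Complex.exp (p.2 * Complex.I) := by
  fun_prop

theorem polarMeasure_one_eq (ν : Measure ℝ) : polarMeasure 1 ν =
    ((volume.restrict (Ioi (0 : ℝ))).prod ν).map
      (fun p : ℝ × ℝ => (p.1 : ℂ) * Complex.exp (p.2 * Complex.I)) := by
  simp [polarMeasure]

theorem polarMeasure_one_apply (ν : Measure ℝ) [SFinite ν] {B : Set ℂ} (hB : MeasurableSet B) :
    polarMeasure 1 ν B = (volume.prod ν)
      {p : ℝ × ℝ | 0 < p.1 ∧ (p.1 : ℂ) * Complex.exp (p.2 * Complex.I) ∈ B} := by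
  have h : (volume.restrict (Ioi (0 : ℝ))).prod ν = (volume.prod ν).restrict (Ioi 0 ×ˢ univ) := by
    rw [← Measure.prod_restrict, Measure.restrict_univ]
  rw [polarMeasure_one_eq, Measure.map_apply measurable_polar hB, h,
    Measure.restrict_apply (measurable_polar hB)]
  congr 1
  ext p
  simp [and_comm]

theorem polarMeasure_closedBall {R : ℝ} :
    polarMeasure 1 uniformAngle (closedBall 0 R) = ENNReal.ofReal R := by
  rw [polarMeasure_one_apply _ measurableSet_closedBall]
  have : {p : ℝ × ℝ | 0 < p.1 ∧ (p.1 : ℂ) * Complex.exp (p.2 * Complex.I) ∈ closedBall 0 R} =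
      Ioc 0 R ×ˢ univ := by
    ext p
    simp only [mem_ofPred_eq, mem_closedBall_zero_iff, norm_mul, Complex.norm_real,
      Complex.norm_exp_ofReal_mul_I, mul_one, mem_prod, mem_Ioc, mem_univ, and_true,
      Real.norm_eq_abs]
    exact and_congr_right fun h => by rw [abs_of_pos h]
  rw [this, Measure.prod_prod, Real.volume_Ioc, measure_univ, mul_one, sub_zero]

theorem integral_polarMeasure {K : ℂ → ℝ} (hK : Continuous K) (hKc : HasCompactSupport K) :
    ∫ a, K a ∂(polarMeasure 1 uniformAngle) = ∫ r in Ioi (0 : ℝ), Real.circleAverage K 0 r := by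
  obtain ⟨S, hS0, hS⟩ := exists_support_radius hKc
  obtain ⟨C, hC⟩ := hKc.exists_bound_of_continuous hK
  rw [polarMeasure_one_eq, integral_map measurable_polar.aemeasurable hK.aestronglyMeasurable,
    integral_prod]
  · refine integral_congr_ae (Eventually.of_forall fun r => ?_)
    simp only [← integral_uniformAngle_circleMap, circleMap_zero]
  · have h1 : Integrable ((Ioo (0 : ℝ) S).indicator fun _ => C) (volume.restrict (Ioi 0)) :=
      ((integrable_indicator_iff measurableSet_Ioo).2 (integrableOn_const (by simp))).restrict
    refine (h1.comp_fst uniformAngle).mono'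
      ((hK.measurable.comp measurable_polar).aestronglyMeasurable) ?_
    have hpos : ∀ᵐ p ∂((volume.restrict (Ioi (0 : ℝ))).prod uniformAngle), 0 < p.1 :=
      (Measure.quasiMeasurePreserving_fst.ae (ae_restrict_mem measurableSet_Ioi))
    filter_upwards [hpos] with p hp
    have hn : ‖(p.1 : ℂ) * Complex.exp (p.2 * Complex.I)‖ = p.1 := by
      rw [norm_mul, Complex.norm_exp_ofReal_mul_I, mul_one, Complex.norm_real, Real.norm_eq_abs,
        abs_of_pos hp]
    rcases lt_or_ge p.1 S with h | h
    · rw [indicator_of_mem (show p.1 ∈ Ioo 0 S from ⟨hp, h⟩)]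
      exact hC _
    · rw [indicator_of_notMem fun h' => (h'.2.trans_le h).false, hS _ (by rw [hn]; exact h),
        norm_zero]

theorem integral_posLog_inv_mul {x : ℝ} (hx : 0 ≤ x) :
    IntegrableOn (fun r : ℝ => Real.posLog (r⁻¹ * x)) (Ioi 0) ∧
      ∫ r in Ioi (0 : ℝ), Real.posLog (r⁻¹ * x) = x := by
  have h0 : ∀ r ∈ Ioi (0 : ℝ), (Ioc 0 x).indicator (fun r => Real.log x - Real.log r) r =
      Real.posLog (r⁻¹ * x) := by
    intro r hr
    rw [mem_Ioi] at hr
    by_cases h : r ≤ x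
    · rw [indicator_of_mem (show r ∈ Ioc 0 x from ⟨hr, h⟩), Real.posLog_eq_log,
        Real.log_mul (inv_ne_zero hr.ne') (hr.trans_le h).ne', Real.log_inv]
      · ring
      · rw [abs_of_nonneg (by positivity), ← div_eq_inv_mul, one_le_div hr]
        exact h
    · rw [indicator_of_notMem fun h' => h h'.2, eq_comm, Real.posLog_eq_zero_iff,
        abs_of_nonneg (by positivity), ← div_eq_inv_mul, div_le_one hr]
      exact (not_le.1 h).le
  have h1 : IntervalIntegrable (fun r => Real.log x - Real.log r) volume 0 x :=
    intervalIntegrable_const.sub intervalIntegral.intervalIntegrable_log'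
  have h2 : Integrable ((Ioc 0 x).indicator fun r => Real.log x - Real.log r) :=
    (integrable_indicator_iff measurableSet_Ioc).2 
      ((intervalIntegrable_iff_integrableOn_Ioc_of_le hx).1 h1)
  refine ⟨h2.integrableOn.congr_fun h0 measurableSet_Ioi, ?_⟩
  rw [← setIntegral_congr_fun measurableSet_Ioi h0, setIntegral_indicator measurableSet_Ioc,
    inter_eq_right.2 Ioc_subset_Ioi_self, ← intervalIntegral.integral_of_le hx,
    intervalIntegral.integral_sub intervalIntegrable_const intervalIntegral.intervalIntegrable_log',
    integral_log, intervalIntegral.integral_const]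
  simp

theorem locallyIntegrable_log_norm_id : LocallyIntegrable fun w : ℂ => Real.log ‖w‖ :=
  locallyIntegrable_log_norm (g := fun w => w) differentiable_id (z₀ := 1) one_ne_zero

/-- Circle averages of the logarithmic potential of a function with vanishing integral. -/
theorem circleAverage_logPotential {ψ : ℂ → ℝ} (hψ : Continuous ψ) (hψc : HasCompactSupport ψ)
    (h0 : ∫ z, ψ z = 0) {r : ℝ} (hr : r ≠ 0) :
    Real.circleAverage (fun a => ∫ z, Real.log ‖z - a‖ * ψ z) 0 r =
      ∫ z, ψ z * Real.posLog (r⁻¹ * ‖z‖) := by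
  have hm : Measurable fun w : ℂ => Real.log ‖w‖ := by fun_prop
  have e1 (a : ℂ) : ∫ z, Real.log ‖z - a‖ * ψ z = ∫ w, Real.log ‖w‖ * ψ (w + a) := by
    rw [← integral_add_right_eq_self _ a]
    simp only [add_sub_cancel_right]
  have e2 : Real.circleAverage (fun a => ∫ w, Real.log ‖w‖ * ψ (w + a)) 0 r =
      ∫ w, Real.log ‖w‖ * Real.circleAverage ψ w r := by
    have hswap := integral_integral_swap (f := fun θ w => Real.log ‖w‖ * ψ (circleMap w r θ))
      (integrable_mul_comp_circleMap locallyIntegrable_log_norm_id hψ hψc r)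
    have e (w : ℂ) (θ : ℝ) : w + circleMap 0 r θ = circleMap w r θ := by simp [circleMap]
    simp only [Real.circleAverage_def, smul_eq_mul, e,
      intervalIntegral.integral_of_le (show (0 : ℝ) ≤ 2 * π by positivity)]
    rw [hswap, ← integral_const_mul]
    refine integral_congr_ae (Eventually.of_forall fun w => ?_)
    simp only
    rw [integral_const_mul]
    ring
  obtain ⟨h3, h4⟩ := integral_mul_circleAverage_comm hm locallyIntegrable_log_norm_id hψ hψc r
  have e5 (z : ℂ) : Real.circleAverage (fun w : ℂ => Real.log ‖w‖) z r =
      Real.log r + Real.posLog (r⁻¹ * ‖z‖) := by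
    have := circleAverage_log_norm_sub_const_eq_log_radius_add_posLog (a := 0) (c := z) hr
    simpa only [sub_zero] using this
  have hψi : Integrable ψ := hψ.integrable_of_hasCompactSupport hψc
  simp only [e1, e2, h4]
  simp only [e5] at h3 ⊢
  have h6 : Integrable fun z => ψ z * Real.posLog (r⁻¹ * ‖z‖) := by
    refine (h3.sub (hψi.mul_const (Real.log r))).congr (Eventually.of_forall fun z => ?_)
    simp only [Pi.sub_apply]
    ring
  simp only [mul_add]
  rw [integral_add (hψi.mul_const _) h6, integral_mul_const, h0, zero_mul, zero_add]

/-- The logarithmic potential of the measure `dr dθ / 2π` is `|z|` up to an (infinite) constant,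
which is invisible to functions of vanishing integral. The potential of a single circle of radius
`r` contributes `log⁺ (|z| / r)`, and the integral of this over `r > 0` is `|z|`. -/
theorem integral_circleAverage_logPotential {ψ : ℂ → ℝ} (hψ : Continuous ψ)
    (hψc : HasCompactSupport ψ) (h0 : ∫ z, ψ z = 0) :
    ∫ r in Ioi (0 : ℝ), Real.circleAverage (fun a => ∫ z, Real.log ‖z - a‖ * ψ z) 0 r =
      ∫ z, ‖z‖ * ψ z := by
  rw [setIntegral_congr_fun measurableSet_Ioi fun r hr =>
    circleAverage_logPotential hψ hψc h0 (ne_of_gt hr)]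
  rw [integral_integral_swap (f := fun (r : ℝ) (z : ℂ) => ψ z * Real.posLog (r⁻¹ * ‖z‖))]
  · refine integral_congr_ae (Eventually.of_forall fun z => ?_)
    simp only
    rw [integral_const_mul, (integral_posLog_inv_mul (norm_nonneg z)).2, mul_comm]
  · have hm : Measurable (Function.uncurry fun (r : ℝ) (z : ℂ) =>
        ψ z * Real.posLog (r⁻¹ * ‖z‖)) :=
      (hψ.measurable.comp measurable_snd).mul (measurable_posLog.comp (by fun_prop))
    rw [integrable_prod_iff' hm.aestronglyMeasurable]
    constructor
    · exact Eventually.of_forall fun z =>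
        (integral_posLog_inv_mul (norm_nonneg z)).1.const_mul (ψ z)
    · have : Integrable fun z => ‖ψ z‖ * ‖z‖ :=
        (hψ.norm.mul continuous_norm).integrable_of_hasCompactSupport hψc.norm.mul_right
      refine this.congr (Eventually.of_forall fun z => ?_)
      simp only [Function.uncurry, norm_mul, Real.norm_eq_abs (Real.posLog _),
        abs_of_nonneg Real.posLog_nonneg]
      rw [integral_const_mul, (integral_posLog_inv_mul (norm_nonneg z)).2]

theorem hasCompactSupport_logKernelConv {χ : ℂ → ℝ} (hχc : HasCompactSupport χ) {s : ℝ}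
    (hs : 0 ≤ s) : HasCompactSupport (logKernelConv s χ) := by
  obtain ⟨S, -, hS⟩ := exists_support_radius hχc
  refine HasCompactSupport.intro (isCompact_closedBall (0 : ℂ) (S + s)) fun a ha => ?_
  rw [mem_closedBall_zero_iff, not_le] at ha
  exact logKernelConv_eq_zero hs hS ha.le

/-- The counterpart for `|z|` and the measure `dr dθ / 2π` of the identity for `log |g|` and the
zeros of `g`. -/
theorem integral_norm_mul_circleAverage_sub {χ : ℂ → ℝ} (hχ : Continuous χ)
    (hχc : HasCompactSupport χ) {s : ℝ} (hs : 0 < s) :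
    ∫ z, ‖z‖ * (Real.circleAverage χ z s - χ z) =
      ∫ a, logKernelConv s χ a ∂(polarMeasure 1 uniformAngle) := by
  have h := integral_circleAverage_logPotential (ψ := fun z => Real.circleAverage χ z s - χ z)
    ((continuous_circleAverage_center hχ s).sub hχ)
    ((hasCompactSupport_circleAverage hχc s).sub hχc) (integral_circleAverage_sub_self hχ hχc s)
  rw [integral_polarMeasure (continuous_logKernelConv hχ hχc s)
      (hasCompactSupport_logKernelConv hχc hs.le), ← h]
  simp only [integral_log_norm_sub_mul hχ hχc hs]

end Polar

/-! ### Angular density of the zeros -/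

section AngularDensity

open Metric EntireGrowth

variable {f : ℂ → ℂ}

theorem isFiniteMeasureOnCompacts_of_closedBall {μ : Measure ℂ}
    (h : ∀ R : ℝ, 0 < R → μ (closedBall 0 R) < ⊤) : IsFiniteMeasureOnCompacts μ := by
  refine ⟨fun K hK => ?_⟩
  obtain ⟨R, hR⟩ := hK.isBounded.subset_closedBall 0
  exact (measure_mono (hR.trans (closedBall_subset_closedBall (le_max_left R 1)))).trans_lt
    (h _ (by positivity))

instance : IsFiniteMeasureOnCompacts (polarMeasure 1 uniformAngle) :=
  isFiniteMeasureOnCompacts_of_closedBall fun R _ => by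
    rw [polarMeasure_closedBall]
    exact ENNReal.ofReal_lt_top

theorem rescaleMeasure_one_apply {t : ℝ} (ht : 0 < t) (μ : Measure ℂ) (B : Set ℂ) :
    rescaleMeasure 1 t μ B = μ ((fun z : ℂ => z / t) ⁻¹' B) / ENNReal.ofReal t := by
  have ht0 : (t : ℂ) ≠ 0 := Complex.ofReal_ne_zero.2 ht.ne'
  have he : MeasurableEmbedding fun z : ℂ => z / t := by
    simp only [div_eq_mul_inv]
    exact (Homeomorph.mulRight₀ (t : ℂ)⁻¹ (inv_ne_zero ht0)).measurableEmbedding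
  rw [rescaleMeasure, Measure.smul_apply, he.map_apply, Real.rpow_neg_one,
    ENNReal.ofReal_inv_of_pos ht, smul_eq_mul, ENNReal.div_eq_inv_mul]

theorem rescaleMeasure_zeroMeasure_closedBall_le (hd : Differentiable ℂ f)
    (hle : ∀ z, ‖f z‖ ≤ Real.exp ‖z‖) (h0 : f 0 = 1) {t R : ℝ} (ht : 0 < t) (hR : 0 < R) :
    rescaleMeasure 1 t (zeroMeasure f) (closedBall 0 R) ≤ ENNReal.ofReal (4 * R) := by
  rw [rescaleMeasure_one_apply ht]
  have h1 : (fun z : ℂ => z / t) ⁻¹' closedBall 0 R = closedBall 0 (t * R) := by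
    ext z
    rw [mem_preimage, mem_closedBall_zero_iff, mem_closedBall_zero_iff, norm_div,
      Complex.norm_real, Real.norm_eq_abs, abs_of_pos ht, div_le_iff₀' ht]
  rw [h1]
  refine ENNReal.div_le_of_le_mul ?_
  rw [← ENNReal.ofReal_mul (by positivity)]
  exact (zeroMeasure_closedBall_zero_le hd hle h0 (by positivity)).trans
    (ENNReal.ofReal_le_ofReal (by linarith))

/-- The convolution with the kernel may be replaced by a multiple of the function under an integral,
with an error controlled by the mass of the measure near the support. -/
theorem abs_integral_logKernelConv_sub_le {χ : ℂ → ℝ} (hχ : Continuous χ)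
    (hχc : HasCompactSupport χ) {S s ω M : ℝ} (hs : 0 ≤ s) (hS : ∀ z, S ≤ ‖z‖ → χ z = 0)
    (hω0 : 0 ≤ ω) (hω : ∀ a w, ‖w‖ ≤ s → |χ (a + w) - χ a| ≤ ω) (hM : 0 ≤ M)
    (μ : Measure ℂ) [IsFiniteMeasureOnCompacts μ]
    (hμ : μ (closedBall 0 (S + s)) ≤ ENNReal.ofReal M) :
    |(∫ a, logKernelConv s χ a ∂μ) - (∫ w : ℂ, Real.posLog (s / ‖w‖)) * ∫ a, χ a ∂μ| ≤
      (∫ w : ℂ, Real.posLog (s / ‖w‖)) * ω * M := by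
  set c := ∫ w : ℂ, Real.posLog (s / ‖w‖) with hc
  have hc0 : 0 ≤ c := integral_nonneg fun _ => Real.posLog_nonneg
  have h1 : Integrable (logKernelConv s χ) μ :=
    (continuous_logKernelConv hχ hχc s).integrable_of_hasCompactSupport
      (hasCompactSupport_logKernelConv hχc hs)
  have h2 : Integrable χ μ := hχ.integrable_of_hasCompactSupport hχc
  rw [← Real.norm_eq_abs, ← integral_const_mul, ← integral_sub h1 (h2.const_mul c),
    ← setIntegral_eq_integral_of_forall_compl_eq_zero (s := closedBall 0 (S + s))]
  · refine (norm_setIntegral_le_of_norm_le_const (hμ.trans_lt ENNReal.ofReal_lt_top) fun a _ =>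
      abs_logKernelConv_sub_le hχ hχc hs a (hω a)).trans ?_
    refine mul_le_mul_of_nonneg_left ?_ (mul_nonneg hc0 hω0)
    exact ENNReal.toReal_le_of_le_ofReal hM hμ
  · intro a ha
    rw [mem_closedBall_zero_iff, not_le] at ha
    rw [logKernelConv_eq_zero hs hS ha.le, hS a (by linarith)]
    ring

theorem integral_logKernelConv_rescaleMeasure (hd : Differentiable ℂ f) (h0 : f 0 = 1)
    {χ : ℂ → ℝ} (hχ : Continuous χ) (hχc : HasCompactSupport χ) {s t : ℝ} (hs : 0 < s)
    (ht : 0 < t) :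
    ∫ a, logKernelConv s χ a ∂(rescaleMeasure 1 t (zeroMeasure f)) =
      ∫ z : ℂ, rescale 1 t (fun w => Real.log ‖f w‖) z * (Real.circleAverage χ z s - χ z) := by
  rw [rescaleMeasure_zeroMeasure ht, integral_smul_measure,
    ← integral_log_norm_mul_circleAverage_sub (differentiable_comp_mul hd t) (z₀ := 0)
      (by simp [h0]) hχ hχc hs, ENNReal.toReal_ofReal (by positivity), smul_eq_mul,
    ← integral_const_mul]
  simp only [rescale, Real.rpow_neg_one, mul_assoc]

/-- The rescaled zero counting measures converge weakly to `dr dθ / 2π`. The limit is first taken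
for `logKernelConv s χ`, which is then compared with a multiple of `χ`, uniformly in `t`. -/
theorem tendsto_integral_rescaleMeasure (hd : Differentiable ℂ f)
    (hle : ∀ z, ‖f z‖ ≤ Real.exp ‖z‖) (h0 : f 0 = 1) (hL : HasLargeValues f) {χ : ℂ → ℝ}
    (hχ : Continuous χ) (hχc : HasCompactSupport χ) :
    Tendsto (fun t : ℝ => ∫ z, χ z ∂(rescaleMeasure 1 t (zeroMeasure f))) atTop
      (𝓝 (∫ z, χ z ∂(polarMeasure 1 uniformAngle))) := by
  obtain ⟨S, hS0, hS⟩ := exists_support_radius hχc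
  rw [Metric.tendsto_atTop']
  intro ε hε
  -- The masses `4 (S + s)` and `S + s` add up to at most `5 (S + 1)`, so the two comparisons of `χ`
  -- with its convolution cost at most `ε / 2` together.
  set ω := ε / (10 * (S + 1)) with hω
  have hω0 : 0 < ω := by positivity
  obtain ⟨δ, hδ0, hδ⟩ := Metric.uniformContinuous_iff.1
    (hχc.uniformContinuous_of_continuous hχ) ω hω0
  set s := min 1 (δ / 2) with hs
  have hs0 : 0 < s := by positivity
  have hs1 : s ≤ 1 := min_le_left _ _
  have hsδ : s < δ := (min_le_right _ _).trans_lt (by linarith)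
  have hosc (a w : ℂ) (hw : ‖w‖ ≤ s) : |χ (a + w) - χ a| ≤ ω := by
    have := hδ (a := a + w) (b := a) (by simpa using hw.trans_lt hsδ)
    rw [Real.dist_eq] at this
    exact this.le
  set c := ∫ w : ℂ, Real.posLog (s / ‖w‖) with hc
  have hc0 : 0 < c := integral_posLog_div_pos hs0
  set ψ : ℂ → ℝ := fun z => Real.circleAverage χ z s - χ z with hψ
  have hlim := tendsto_integral_rescale_log_norm hd hle h0 hL (ψ := ψ)
    ((continuous_circleAverage_center hχ s).sub hχ)
    ((hasCompactSupport_circleAverage hχc s).sub hχc)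
  rw [integral_norm_mul_circleAverage_sub hχ hχc hs0, Metric.tendsto_atTop] at hlim
  obtain ⟨N, hN⟩ := hlim (c * (ε / 2)) (by positivity)
  refine ⟨max N 0, fun t ht => ?_⟩
  have ht0 : 0 < t := (le_max_right _ _).trans_lt ht
  have hNt := hN t ((le_max_left _ _).trans ht.le)
  rw [← integral_logKernelConv_rescaleMeasure hd h0 hχ hχc hs0 ht0, Real.dist_eq] at hNt
  have hfin : IsFiniteMeasureOnCompacts (rescaleMeasure 1 t (zeroMeasure f)) :=
    isFiniteMeasureOnCompacts_of_closedBall fun R hR =>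
      (rescaleMeasure_zeroMeasure_closedBall_le hd hle h0 ht0 hR).trans_lt ENNReal.ofReal_lt_top
  have h1 := abs_integral_logKernelConv_sub_le hχ hχc hs0.le hS hω0.le hosc
    (M := 4 * (S + s)) (by positivity) (rescaleMeasure 1 t (zeroMeasure f))
    (rescaleMeasure_zeroMeasure_closedBall_le hd hle h0 ht0 (by positivity))
  have h2 := abs_integral_logKernelConv_sub_le hχ hχc hs0.le hS hω0.le hosc
    (M := S + s) (by positivity) (polarMeasure 1 uniformAngle) polarMeasure_closedBall.le
  rw [← hc] at h1 h2
  have h3 : ω * (S + s) ≤ ε / 10 := by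
    have : ω * (S + 1) = ε / 10 := by rw [hω]; field_simp
    rw [← this]
    gcongr
  have h4 := mul_le_mul_of_nonneg_left h3 hc0.le
  rw [Real.dist_eq]
  refine lt_of_mul_lt_mul_left ?_ hc0.le
  rw [← abs_of_pos hc0, ← abs_mul, abs_of_pos hc0, abs_lt]
  rw [abs_le] at h1 h2
  rw [abs_lt] at hNt
  constructor <;> linarith [h1.1, h1.2, h2.1, h2.2, hNt.1, hNt.2]

/-- Lower semicontinuity of the mass of open sets under weak convergence. -/
theorem eventually_le_rescaleMeasure_add (hd : Differentiable ℂ f)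
    (hle : ∀ z, ‖f z‖ ≤ Real.exp ‖z‖) (h0 : f 0 = 1) (hL : HasLargeValues f) {U : Set ℂ}
    (hU : IsOpen U) (hfin : polarMeasure 1 uniformAngle U ≠ ⊤) {δ : ℝ≥0∞} (hδ : δ ≠ 0) :
    ∀ᶠ t : ℝ in atTop, polarMeasure 1 uniformAngle U ≤
      rescaleMeasure 1 t (zeroMeasure f) U + δ := by
  rcases eq_or_ne (polarMeasure 1 uniformAngle U) 0 with h | h
  · simp [h]
  have hlt := ENNReal.sub_lt_self hfin h hδ
  obtain ⟨K, hKU, hK, hKlt⟩ := hU.exists_lt_isCompact hlt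
  obtain ⟨χ, hχK, hχc, hχU, hχ⟩ := exists_continuousMap_one_of_isCompact_subset_isOpen hK hU hKU
  have hχint : Integrable χ (polarMeasure 1 uniformAngle) :=
    χ.continuous.integrable_of_hasCompactSupport hχc
  have hle1 : polarMeasure 1 uniformAngle K ≤
      ENNReal.ofReal (∫ z, χ z ∂(polarMeasure 1 uniformAngle)) := by
    rw [ofReal_integral_eq_lintegral_ofReal hχint (Eventually.of_forall fun z => (hχ z).1),
      ← setLIntegral_one]
    refine (setLIntegral_mono' hK.measurableSet fun z hz => ?_).trans
      (setLIntegral_le_lintegral K _)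
    rw [hχK hz]
    simp
  have hlim := ENNReal.tendsto_ofReal
    (tendsto_integral_rescaleMeasure hd hle h0 hL χ.continuous hχc)
  filter_upwards [hlim.eventually (eventually_gt_nhds (hKlt.trans_le hle1))] with t ht
  refine tsub_le_iff_right.1
    (ht.le.trans (integral_le_measure (fun z _ => (hχ z).2) fun z hz => ?_))
  exact (image_eq_zero_of_notMem_tsupport fun h => hz (hχU h)).le

theorem eventually_rescaleMeasure_closedBall_le (hd : Differentiable ℂ f)
    (hle : ∀ z, ‖f z‖ ≤ Real.exp ‖z‖) (h0 : f 0 = 1) (hL : HasLargeValues f) {δ : ℝ}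
    (hδ : 0 < δ) :
    ∀ᶠ t : ℝ in atTop, rescaleMeasure 1 t (zeroMeasure f) (closedBall 0 1) ≤
      ENNReal.ofReal (1 + δ) := by
  obtain ⟨χ, hχK, hχc, hχU, hχ⟩ := exists_continuousMap_one_of_isCompact_subset_isOpen
    (isCompact_closedBall (0 : ℂ) 1) (isOpen_ball (x := (0 : ℂ)) (ε := 1 + δ / 2))
    (closedBall_subset_ball (by linarith))
  have hle1 : ∫ z, χ z ∂(polarMeasure 1 uniformAngle) ≤ 1 + δ / 2 := by
    rw [← ENNReal.ofReal_le_ofReal_iff (by positivity), ← polarMeasure_closedBall (R := 1 + δ / 2)]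
    refine integral_le_measure (fun z _ => (hχ z).2) fun z hz => ?_
    exact (image_eq_zero_of_notMem_tsupport fun h => hz (ball_subset_closedBall (hχU h))).le
  have hlim := tendsto_integral_rescaleMeasure hd hle h0 hL χ.continuous hχc
  filter_upwards [hlim.eventually (eventually_lt_nhds (show _ < 1 + δ by linarith)),
    eventually_gt_atTop 0] with t ht ht0
  have hfin : IsFiniteMeasureOnCompacts (rescaleMeasure 1 t (zeroMeasure f)) :=
    isFiniteMeasureOnCompacts_of_closedBall fun R hR =>
      (rescaleMeasure_zeroMeasure_closedBall_le hd hle h0 ht0 hR).trans_lt ENNReal.ofReal_lt_top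
  refine le_trans ?_ (ENNReal.ofReal_le_ofReal ht.le)
  rw [ofReal_integral_eq_lintegral_ofReal (χ.continuous.integrable_of_hasCompactSupport hχc)
    (Eventually.of_forall fun z => (hχ z).1), ← setLIntegral_one]
  refine (setLIntegral_mono' measurableSet_closedBall fun z hz => ?_).trans
    (setLIntegral_le_lintegral _ _)
  rw [hχK hz]
  simp

end AngularDensity

/-! ### Zeros in sectors -/

section Sectors

open Metric EntireGrowth

variable {f : ℂ → ℂ}

theorem eq_of_exp_mul_I_eq {x y : ℝ}
    (h : Complex.exp (x * Complex.I) = Complex.exp (y * Complex.I)) (h1 : |x - y| < 2 * π) :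
    x = y := by
  obtain ⟨n, hn⟩ := Complex.exp_eq_exp_iff_exists_int.1 h
  have h2 : x = y + n * (2 * π) := by
    have := congrArg Complex.im hn
    simpa using this
  have h3 : |(n : ℝ)| < 1 := by
    rw [h2, add_sub_cancel_left, abs_mul, abs_of_pos (show (0 : ℝ) < 2 * π by positivity)] at h1
    exact (mul_lt_iff_lt_one_left (by positivity)).1 h1
  have h4 : n = 0 := Int.abs_lt_one_iff.1 (by exact_mod_cast h3)
  simpa [h4] using h2

theorem mul_exp_mem_sector_iff {θ₁ θ₂ r s θ : ℝ} (hs : 0 < s) :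
    (s : ℂ) * Complex.exp (θ * Complex.I) ∈ sector θ₁ θ₂ r ↔ s < r ∧ ∃ θ' : ℝ,
      θ₁ < θ' ∧ θ' < θ₂ ∧ Complex.exp (θ * Complex.I) = Complex.exp (θ' * Complex.I) := by
  constructor
  · rintro ⟨s', θ', h1, h2, h3, h4, h5⟩
    have h6 : s = s' := by
      have := congrArg norm h5
      simpa [norm_mul, Complex.norm_exp_ofReal_mul_I, abs_of_pos hs, abs_of_pos h1] using this
    subst h6
    exact ⟨h2, θ', h3, h4, mul_left_cancel₀ (Complex.ofReal_ne_zero.2 hs.ne') h5⟩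
  · rintro ⟨h1, θ', h2, h3, h4⟩
    exact ⟨s, θ', hs, h1, h2, h3, by rw [h4]⟩

theorem isOpen_sector (θ₁ θ₂ r : ℝ) : IsOpen (sector θ₁ θ₂ r) := by
  rcases le_or_gt r 0 with hr | hr
  · convert isOpen_empty (X := ℂ)
    rw [eq_empty_iff_forall_notMem]
    rintro z ⟨s, θ, h1, h2, -⟩
    linarith
  have : sector θ₁ θ₂ r =
      Complex.exp '' {w | w.re < Real.log r ∧ θ₁ < w.im ∧ w.im < θ₂} := by
    ext z
    constructor
    · rintro ⟨s, θ, h1, h2, h3, h4, rfl⟩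
      refine ⟨Real.log s + θ * Complex.I, ⟨by simpa using Real.log_lt_log h1 h2, by simpa using h3,
        by simpa using h4⟩, ?_⟩
      rw [Complex.exp_add, ← Complex.ofReal_exp, Real.exp_log h1]
    · rintro ⟨w, ⟨h1, h2, h3⟩, rfl⟩
      refine ⟨Real.exp w.re, w.im, Real.exp_pos _, (Real.lt_log_iff_exp_lt hr).1 h1, h2, h3, ?_⟩
      rw [Complex.ofReal_exp, ← Complex.exp_add, Complex.re_add_im]
  rw [this]
  refine Complex.isOpenMap_exp _ ?_
  exact (isOpen_lt Complex.continuous_re continuous_const).inter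
    ((isOpen_lt continuous_const Complex.continuous_im).inter
      (isOpen_lt Complex.continuous_im continuous_const))

theorem sector_subset_closedBall (θ₁ θ₂ r : ℝ) : sector θ₁ θ₂ r ⊆ closedBall 0 r := by
  rintro z ⟨s, θ, h1, h2, -, -, rfl⟩
  rw [mem_closedBall_zero_iff, norm_mul, Complex.norm_exp_ofReal_mul_I, mul_one, Complex.norm_real,
    Real.norm_eq_abs, abs_of_pos h1]
  exact h2.le

theorem disjoint_sector (θ₁ θ₂ r : ℝ) :
    Disjoint (sector θ₁ θ₂ r) (sector θ₂ (θ₁ + 2 * π) r) := by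
  rw [Set.disjoint_left]
  rintro z ⟨s, θ, h1, -, h3, h4, rfl⟩ h
  obtain ⟨-, θ', h5, h6, h7⟩ := (mul_exp_mem_sector_iff h1).1 h
  have := eq_of_exp_mul_I_eq h7 (by rw [abs_lt]; constructor <;> linarith)
  linarith

theorem polarMeasure_sector {θ₁ θ₂ : ℝ} (h2 : θ₂ ≤ θ₁ + 2 * π) :
    polarMeasure 1 uniformAngle (sector θ₁ θ₂ 1) = ENNReal.ofReal ((θ₂ - θ₁) / (2 * π)) := by
  set T : Set ℝ := (fun θ : ℝ => ((1 / 2 : ℝ) : ℂ) * Complex.exp (θ * Complex.I)) ⁻¹'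
    sector θ₁ θ₂ 1 with hT
  have hTm : MeasurableSet T := (isOpen_sector θ₁ θ₂ 1).measurableSet.preimage (by fun_prop)
  have hmem (θ : ℝ) : θ ∈ T ↔ ∃ θ' : ℝ, θ₁ < θ' ∧ θ' < θ₂ ∧
      Complex.exp (θ * Complex.I) = Complex.exp (θ' * Complex.I) := by
    rw [hT, mem_preimage, mul_exp_mem_sector_iff (by norm_num)]
    exact and_iff_right (by norm_num)
  have hset : {p : ℝ × ℝ | 0 < p.1 ∧ (p.1 : ℂ) * Complex.exp (p.2 * Complex.I) ∈
      sector θ₁ θ₂ 1} = Ioo 0 1 ×ˢ T := by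
    ext p
    rw [mem_ofPred_eq, mem_prod, mem_Ioo, and_assoc, hmem]
    exact and_congr_right fun h => mul_exp_mem_sector_iff h
  have hinv (g : AddSubgroup.zmultiples (2 * π)) : (fun x : ℝ => g +ᵥ x) ⁻¹' T = T := by
    obtain ⟨_, n, rfl⟩ := g
    ext θ
    have : Complex.exp (((n • (2 * π) + θ : ℝ) : ℂ) * Complex.I) =
        Complex.exp (θ * Complex.I) := by
      rw [Complex.exp_eq_exp_iff_exists_int]
      refine ⟨n, ?_⟩
      push_cast [zsmul_eq_mul]
      ring
    rw [mem_preimage, AddSubgroup.vadd_def, vadd_eq_add, hmem, hmem, this]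
  have hpi : (0 : ℝ) < 2 * π := by positivity
  -- `T` is invariant under `2π`, so its measure may be computed on the period starting at `θ₁`.
  have hfund := (isAddFundamentalDomain_Ioc hpi (-π)).measure_set_eq
    (isAddFundamentalDomain_Ioc hpi θ₁) hTm hinv
  have hinter : T ∩ Ioc θ₁ (θ₁ + 2 * π) = Ioo θ₁ θ₂ := by
    ext θ
    constructor
    · rintro ⟨h, h3, h4⟩
      obtain ⟨θ', h5, h6, h7⟩ := (hmem θ).1 h
      rw [eq_of_exp_mul_I_eq h7 (by rw [abs_lt]; constructor <;> linarith)]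
      exact ⟨h5, h6⟩
    · rintro ⟨h3, h4⟩
      exact ⟨(hmem θ).2 ⟨θ, h3, h4, rfl⟩, h3, by linarith⟩
  rw [polarMeasure_one_apply _ (isOpen_sector θ₁ θ₂ 1).measurableSet, hset, Measure.prod_prod,
    uniformAngle, Measure.smul_apply, Measure.restrict_apply hTm,
    show Ioc (-π) π = Ioc (-π) (-π + 2 * π) by ring_nf, hfund, hinter, Real.volume_Ioo,
    Real.volume_Ioo, smul_eq_mul, ← ENNReal.ofReal_mul (by positivity), sub_zero,
    ENNReal.ofReal_one, one_mul]
  congr 1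
  ring

theorem zeroMeasure_sector_div {θ₁ θ₂ r : ℝ} (hr : 0 < r) :
    zeroMeasure f (sector θ₁ θ₂ r) / ENNReal.ofReal r =
      rescaleMeasure 1 r (zeroMeasure f) (sector θ₁ θ₂ 1) := by
  rw [rescaleMeasure_one_apply hr]
  congr 2
  have hr0 : (r : ℂ) ≠ 0 := Complex.ofReal_ne_zero.2 hr.ne'
  ext z
  constructor
  · rintro ⟨s, θ, h1, h2, h3, h4, rfl⟩
    refine ⟨s / r, θ, by positivity, (div_lt_one hr).2 h2, h3, h4, ?_⟩
    push_cast
    ring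
  · rintro ⟨s, θ, h1, h2, h3, h4, h5⟩
    refine ⟨r * s, θ, by positivity, by nlinarith, h3, h4, ?_⟩
    rw [div_eq_iff hr0] at h5
    rw [h5]
    push_cast
    ring

/-- Weak convergence bounds the number of zeros in open sectors from below. The upper bound for a
sector follows from the lower bound for the complementary sector and the upper bound for the disc,
as the two limits add up to the mass of the disc. -/
theorem tendsto_zeroMeasure_sector (hd : Differentiable ℂ f)
    (hle : ∀ z, ‖f z‖ ≤ Real.exp ‖z‖) (h0 : f 0 = 1) (hL : HasLargeValues f) {θ₁ θ₂ : ℝ}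
    (h1 : θ₁ ≤ θ₂) (h2 : θ₂ ≤ θ₁ + 2 * π) :
    Tendsto (fun r : ℝ => zeroMeasure f (sector θ₁ θ₂ r) / ENNReal.ofReal r) atTop
      (𝓝 (ENNReal.ofReal ((θ₂ - θ₁) / (2 * π)))) := by
  have hpi : (0 : ℝ) < 2 * π := by positivity
  set p := (θ₂ - θ₁) / (2 * π) with hp
  have hp0 : 0 ≤ p := div_nonneg (by linarith) hpi.le
  have hp1 : p ≤ 1 := (div_le_one hpi).2 (by linarith)
  have hm1 := polarMeasure_sector h2
  have hm2 := polarMeasure_sector (θ₁ := θ₂) (θ₂ := θ₁ + 2 * π) (by linarith)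
  rw [← hp] at hm1
  rw [show (θ₁ + 2 * π - θ₂) / (2 * π) = 1 - p by rw [hp]; field_simp; ring] at hm2
  rw [ENNReal.tendsto_nhds ENNReal.ofReal_ne_top]
  intro ε hε
  obtain ⟨δ, hδ0, hδε⟩ : ∃ δ : ℝ, 0 < δ ∧ ENNReal.ofReal (2 * δ) ≤ ε := by
    rcases eq_or_ne ε ⊤ with h | h
    · exact ⟨1, one_pos, by simp [h]⟩
    · have := ENNReal.toReal_pos hε.ne' h
      refine ⟨ε.toReal / 2, by positivity, ?_⟩
      rw [mul_div_cancel₀ _ two_ne_zero, ENNReal.ofReal_toReal h]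
  have hδne : ENNReal.ofReal δ ≠ 0 := (ENNReal.ofReal_pos.2 hδ0).ne'
  filter_upwards [eventually_gt_atTop 0,
    eventually_le_rescaleMeasure_add hd hle h0 hL (isOpen_sector θ₁ θ₂ 1)
      (by rw [hm1]; exact ENNReal.ofReal_ne_top) hδne,
    eventually_le_rescaleMeasure_add hd hle h0 hL (isOpen_sector θ₂ (θ₁ + 2 * π) 1)
      (by rw [hm2]; exact ENNReal.ofReal_ne_top) hδne,
    eventually_rescaleMeasure_closedBall_le hd hle h0 hL hδ0] with r hr hl1 hl2 hb
  rw [zeroMeasure_sector_div hr, mem_Icc]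
  rw [hm1] at hl1
  rw [hm2] at hl2
  constructor
  · rw [tsub_le_iff_right]
    refine hl1.trans ?_
    gcongr
    exact (ENNReal.ofReal_le_ofReal (by linarith)).trans hδε
  · set m := rescaleMeasure 1 r (zeroMeasure f) (sector θ₁ θ₂ 1)
    set m' := rescaleMeasure 1 r (zeroMeasure f) (sector θ₂ (θ₁ + 2 * π) 1)
    have hadd : m + m' ≤ ENNReal.ofReal (1 + δ) := by
      refine le_trans (le_of_eq ?_) ((measure_mono (union_subset
        (sector_subset_closedBall θ₁ θ₂ 1) (sector_subset_closedBall θ₂ (θ₁ + 2 * π) 1))).trans hb)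
      exact (measure_union (disjoint_sector θ₁ θ₂ 1) (isOpen_sector _ _ _).measurableSet).symm
    have hsum : m + ENNReal.ofReal (1 - p) ≤
        ENNReal.ofReal (p + 2 * δ) + ENNReal.ofReal (1 - p) := by
      calc m + ENNReal.ofReal (1 - p) ≤ m + (m' + ENNReal.ofReal δ) := by gcongr
        _ = m + m' + ENNReal.ofReal δ := (add_assoc _ _ _).symm
        _ ≤ ENNReal.ofReal (1 + δ) + ENNReal.ofReal δ := by gcongr
        _ = ENNReal.ofReal (p + 2 * δ) + ENNReal.ofReal (1 - p) := by
          rw [← ENNReal.ofReal_add (by positivity) hδ0.le,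
            ← ENNReal.ofReal_add (by positivity) (by linarith)]
          congr 1
          ring
    refine ((ENNReal.add_le_add_iff_right ENNReal.ofReal_ne_top).1 hsum).trans ?_
    rw [ENNReal.ofReal_add hp0 (by positivity)]
    gcongr

end Sectors

theorem theorem3 (α : ℝ) (hα : Irrational α) (f : ℂ → ℂ)
    (hf : ∀ z : ℂ, HasSum
      (fun n : ℕ => Complex.exp (2 * π * Complex.I * (n : ℂ) ^ 2 * α) * z ^ n / (n ! : ℂ)) (f z)) :
    EntireGrowth.CompletelyRegularGrowth 1 f ∧
    (∀ θ : ℝ, EntireGrowth.plIndicator 1 f θ = 1) ∧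
    (∃ E : Set ℂ, (∀ η : ℝ, 0 < η → EntireGrowth.IsSmallExceptional η E) ∧
      ∀ ε : ℝ, 0 < ε → ∃ R : ℝ, ∀ z : ℂ, R ≤ ‖z‖ → z ∉ E →
        f z ≠ 0 ∧ |Real.log ‖f z‖ - ‖z‖| ≤ ε * ‖z‖) ∧
    EntireGrowth.HasAngularDensity 1 f EntireGrowth.uniformAngle ∧
    (∀ θ₁ θ₂ : ℝ, θ₁ < θ₂ → θ₂ ≤ θ₁ + 2 * π →
      Tendsto (fun r : ℝ => EntireGrowth.zeroMeasure f (EntireGrowth.sector θ₁ θ₂ r) /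
        ENNReal.ofReal r) atTop (𝓝 (ENNReal.ofReal ((θ₂ - θ₁) / (2 * π))))) := by
  set q := Complex.exp (2 * π * Complex.I * α) with hq_def
  have hq : ‖q‖ = 1 := by
    rw [hq_def, show (2 * π * Complex.I * α : ℂ) = ((2 * π * α : ℝ) : ℂ) * Complex.I by
      push_cast; ring, Complex.norm_exp_ofReal_mul_I]
  have hp : ‖q ^ 2‖ = 1 := by rw [norm_pow, hq, one_pow]
  have hp_eq : q ^ 2 = Complex.exp (2 * π * Complex.I * ((2 * α : ℝ) : ℂ)) := by
    rw [hq_def, ← Complex.exp_nat_mul]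
    congr 1
    push_cast
    ring
  have hsum (z : ℂ) : HasSum (fun n : ℕ => q ^ (n ^ 2) * z ^ n / (n ! : ℂ)) (f z) := by
    convert! hf z using 4 with n
    rw [hq_def, ← Complex.exp_nat_mul]
    congr 1
    push_cast
    ring
  have hder := hasDerivAt_of_hasSum_sq hq hsum
  have hd : Differentiable ℂ f := fun z => (hder z).differentiableAt
  have hle := norm_le_exp_of_hasSum_sq hq hsum
  have h0 : f 0 = 1 := by
    refine (hsum 0).unique ?_
    convert! hasSum_single (f := fun n : ℕ => q ^ (n ^ 2) * (0 : ℂ) ^ n / (n ! : ℂ)) 0 ?_ using 1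
    · simp
    · intro n hn
      simp [hn]
  have h2α : Irrational (2 * α) := by
    simpa using hα.natCast_mul (m := 2) two_ne_zero
  have hL : HasLargeValues f := hasLargeValues_of_hasDerivAt hp hq hder h0 fun δ hδ => by
    rw [hp_eq]
    exact exists_bound_pow_near h2α δ hδ
  have hlow (l r : ℝ) (hl0 : 0 ≤ l) (hl1 : l < 1) (hr : 0 < r) :
      Real.exp (l * r) ≤ EntireGrowth.maxModulus f r / (1 - l) :=
    exp_le_of_norm_le_on_sphere hp hq hder h0 hr hl0 hl1 fun z hz => by
      rw [← hz]
      exact norm_le_maxModulus hle z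
  have hcov (ε η : ℝ) (hε : 0 < ε) (hη : 0 < η) : ∀ᶠ k : ℕ in atTop, HasShellCover f ε η k :=
    eventually_hasShellCover hd hle h0 hL hε hη
  exact ⟨completelyRegularGrowth_of_hasLargeValues hd hle h0 hL hlow, plIndicator_eq_one hle hcov,
    exists_exceptional_set hcov,
    fun χ => tendsto_integral_rescaleMeasure hd hle h0 hL χ.continuous χ.hasCompactSupport,
    fun _ _ h1 h2 => tendsto_zeroMeasure_sector hd hle h0 hL h1.le h2⟩
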